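/- Let $d\in\mathbb N$, $s>1$, and let $U\subseteq\mathbb R^d$ be a bounded open set. All functions are complex valued; for a multi-index $\alpha\in\mathbb N^d$ write $|\alpha|=\sum_j\alpha_j$, $\alpha!=\prod_j\alpha_j!$. **Spaces.** For $h>0$ and a compact set $K\subset\mathbb R^d$ let $\mathcal D^{s,h}_K$ be the space of all $f\in C^\infty(\mathbb R^d)$ with support in $K$ and finite norm $\sup_{\alpha}\sup_{x\in K} h^{|\alpha|}|D^\alpha f(x)|/\alpha!^s$. Let $\mathcal D^{(s)}_K=\varprojlim_{h\to\infty}\mathcal D^{s,h}_K$ (the intersection over all $h>0$ with the projective limit topology), and let $\mathcal D^{(s)}(U)$ be the union of the $\mathcal D^{(s)}_K$ over the compact sets $K\subseteq U$. For $1\le p\le\infty$ let $\mathcal D^s_{L^p,h}(U)$ be the space of all $\varphi\in C^\infty(U)$ with finite norm $\bigl(\sum_\alpha h^{p|\alpha|}\|D^\alpha\varphi\|_{L^p(U)}^p/\alpha!^{ps}\bigr)^{1/p}$ (respectively $\sup_\alpha h^{|\alpha|}\|D^\alpha\varphi\|_{L^\infty(U)}/\alpha!^s$ if $p=\infty$),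 and let $\mathcal D^{(s)}_{L^p,h}(U)$ be the closure of $\mathcal D^{(s)}(U)$ in $\mathcal D^s_{L^p,h}(U)$, with the induced norm. Let $\mathcal B^{(s)}_{L^\infty}(U)=\varprojlim_{h\to\infty}\mathcal D^s_{L^\infty,h}(U)$, and let $\dot{\mathcal B}^{(s)}(U)$ be the closure of $\mathcal D^{(s)}(U)$ in $\mathcal B^{(s)}_{L^\infty}(U)$, with the induced topology. An (FS)-space is a locally convex space that is the projective limit of a sequence of Banach spaces with compact linking maps. A Hausdorff locally convex space $E$ is nuclear if for every continuous seminorm $q$ the canonical map from $E$ to the completion $\hat E_q$ of $E/\ker q$ is nuclear. **Statement.** (i) Let $h>0$. For every $1\le p\le\infty$, every $\varphi\in\mathcal D^{(s)}_{L^p,h}(U)$ extends to a $C^\infty$ function on $\mathbb R^d$ with support in $\overline U$. Moreover, extension by zero is a linear isometry from $\mathcal D^{(s)}_{L^\infty,h}(U)$ onto a closed subspace of $\mathcal D^{s,h}_{\overline U}$. (ii) Extension by zero is a linear homeomorphism from $\dot{\mathcal B}^{(s)}(U)$ onto a closed subspace of $\mathcal D^{(s)}_{\overline U}$. (iii) $\dot{\mathcal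 B}^{(s)}(U)$ is a nuclear (FS)-space. Moreover, $\dot{\mathcal B}^{(s)}(U)=\varprojlim_{h\to\infty}\mathcal D^{(s)}_{L^\infty,h}(U)$ as locally convex spaces, and in this representation the linking inclusions $\mathcal D^{(s)}_{L^\infty,h_1}(U)\to\mathcal D^{(s)}_{L^\infty,h}(U)$ are compact for all $h_1>h>0$. -/

import Mathlib

open MeasureTheory TopologicalSpace Topology
open scoped ContDiff

noncomputable section

namespace Gevrey

/-! ### Multi-indices, partial derivatives, weights -/

/-- The Euclidean space `ℝ^d`. -/
abbrev Eu (d : ℕ) : Type := EuclideanSpace ℝ (Fin d)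

variable {d : ℕ}

/-- The list of coordinate directions in which `∂^α` differentiates: the coordinate `j` is
listed `α j` times. -/
def dirs (α : Fin d → ℕ) : List (Fin d) :=
  (List.finRange d).flatMap fun j => List.replicate (α j) j

theorem dirs_length (α : Fin d → ℕ) : (dirs α).length = ∑ j, α j := by
  simp [dirs, List.length_flatMap, Fin.sum_univ_def]

theorem count_dirs (α : Fin d → ℕ) (i : Fin d) : (dirs α).count i = α i := by
  simp only [dirs, List.count_flatMap]
  have h : (List.count i ∘ fun j => List.replicate (α j) j) = fun j => if j = i then α i else 0 := by
    funext j
    by_cases hj : j = i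
    · subst hj; simp
    · simp [List.count_replicate, hj]
  rw [h, ← Fin.sum_univ_def]
  simp

/-- The partial derivative `∂^α f (x)`. Here `∂^α` replaces `D^α = i^{-|α|} ∂^α`: only the absolute
values of the derivatives matter below. -/
def pderiv (α : Fin d → ℕ) (f : Eu d → ℂ) (x : Eu d) : ℂ :=
  iteratedFDeriv ℝ (dirs α).length f x fun i => EuclideanSpace.single ((dirs α).get i) (1 : ℝ)

/-- The weight `h^{|α|} / α!^s`. -/
def weight (s h : ℝ) (α : Fin d → ℕ) : ℝ :=
  h ^ (∑ j, α j) / ((∏ j, (α j).factorial : ℕ) : ℝ) ^ s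

theorem weight_pos (s : ℝ) {h : ℝ} (hh : 0 < h) (α : Fin d → ℕ) : 0 < weight s h α := by
  have : (0 : ℝ) < ((∏ j, (α j).factorial : ℕ) : ℝ) := by
    exact_mod_cast Finset.prod_pos fun j _ => (α j).factorial_pos
  unfold weight
  positivity

theorem pderiv_add (α : Fin d → ℕ) {f g : Eu d → ℂ} {x : Eu d}
    (hf : ContDiffAt ℝ ∞ f x) (hg : ContDiffAt ℝ ∞ g x) :
    pderiv α (f + g) x = pderiv α f x + pderiv α g x := by
  unfold pderiv
  rw [iteratedFDeriv_add_apply (hf.of_le (by exact_mod_cast le_top))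
    (hg.of_le (by exact_mod_cast le_top))]
  rfl

theorem pderiv_smul (α : Fin d → ℕ) (c : ℂ) {f : Eu d → ℂ} {x : Eu d}
    (hf : ContDiffAt ℝ ∞ f x) : pderiv α (c • f) x = c * pderiv α f x := by
  unfold pderiv
  rw [iteratedFDeriv_const_smul_apply (hf.of_le (by exact_mod_cast le_top))]
  rfl

theorem pderiv_zero (f : Eu d → ℂ) : pderiv 0 f = f := by
  have h0 : (dirs (0 : Fin d → ℕ)) = [] := List.length_eq_zero_iff.1 (by simp [dirs_length])
  funext x
  unfold pderiv
  rw [h0]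
  simp

/-! ### The spaces `D^{s,h}_K` and `D^{(s)}_K` -/

/-- `sup_α sup_{x ∈ K} h^{|α|} |∂^α f(x)| / α!^s`. -/
def supENorm (s h : ℝ) (K : Set (Eu d)) (f : Eu d → ℂ) : ENNReal :=
  ⨆ α : Fin d → ℕ, ⨆ x ∈ K, ENNReal.ofReal (weight s h α) * ‖pderiv α f x‖ₑ

theorem supENorm_ge (s h : ℝ) {K : Set (Eu d)} {x : Eu d} (hx : x ∈ K) (f : Eu d → ℂ)
    (α : Fin d → ℕ) : ENNReal.ofReal (weight s h α) * ‖pderiv α f x‖ₑ ≤ supENorm s h K f :=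
  (le_iSup₂ (f := fun x (_ : x ∈ K) => ENNReal.ofReal (weight s h α) * ‖pderiv α f x‖ₑ) x hx).trans
    (le_iSup (fun α => ⨆ x ∈ K, ENNReal.ofReal (weight s h α) * ‖pderiv α f x‖ₑ) α)

theorem supENorm_add_le (s h : ℝ) (K : Set (Eu d)) {f g : Eu d → ℂ}
    (hf : ContDiff ℝ ∞ f) (hg : ContDiff ℝ ∞ g) :
    supENorm s h K (f + g) ≤ supENorm s h K f + supENorm s h K g := by
  refine iSup_le fun α => iSup₂_le fun x hx => ?_
  rw [pderiv_add α hf.contDiffAt hg.contDiffAt]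
  calc _ ≤ ENNReal.ofReal (weight s h α) * (‖pderiv α f x‖ₑ + ‖pderiv α g x‖ₑ) := by
        gcongr; exact enorm_add_le _ _
    _ = _ := mul_add _ _ _
    _ ≤ _ := add_le_add (supENorm_ge s h hx f α) (supENorm_ge s h hx g α)

theorem supENorm_smul (s h : ℝ) (K : Set (Eu d)) (c : ℂ) {f : Eu d → ℂ}
    (hf : ContDiff ℝ ∞ f) : supENorm s h K (c • f) = ‖c‖ₑ * supENorm s h K f := by
  simp only [supENorm, ENNReal.mul_iSup]
  refine iSup_congr fun α => iSup_congr fun x => iSup_congr fun _ => ?_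
  rw [pderiv_smul α c hf.contDiffAt, enorm_mul]
  ring

theorem supENorm_zero (s h : ℝ) (K : Set (Eu d)) : supENorm s h K 0 = 0 := by
  have := supENorm_smul s h K 0 (f := 0) contDiff_const
  simpa using this

/-- The functions in `C^∞(ℝ^d)` with support in `K` and with
`sup_α sup_{x ∈ K} h^{|α|} |∂^α f(x)| / α!^s < ∞`. -/
def compSubmodule (s h : ℝ) (K : Set (Eu d)) : Submodule ℂ (Eu d → ℂ) where
  carrier := {f | ContDiff ℝ ∞ f ∧ tsupport f ⊆ K ∧ supENorm s h K f < ⊤}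
  zero_mem' := ⟨contDiff_const, by simp [tsupport], by
    change supENorm s h K 0 < ⊤
    rw [supENorm_zero]; exact ENNReal.zero_lt_top⟩
  add_mem' := by
    rintro f g ⟨hf, hfK, hf'⟩ ⟨hg, hgK, hg'⟩
    exact ⟨hf.add hg, (tsupport_add f g).trans (Set.union_subset hfK hgK),
      (supENorm_add_le s h K hf hg).trans_lt (ENNReal.add_lt_top.2 ⟨hf', hg'⟩)⟩
  smul_mem' := by
    rintro c f ⟨hf, hfK, hf'⟩
    refine ⟨hf.const_smul c, (closure_mono ?_).trans hfK, ?_⟩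
    · exact Function.support_const_smul_subset c f
    · rw [supENorm_smul s h K c hf]
      exact ENNReal.mul_lt_top enorm_lt_top hf'

/-- The space `D^{s,h}_K`, as a type. -/
def Comp (s : ℝ) (h : Set.Ioi (0 : ℝ)) (K : Set (Eu d)) : Type := compSubmodule s h.1 K

instance (s : ℝ) (h : Set.Ioi (0 : ℝ)) (K : Set (Eu d)) : AddCommGroup (Comp s h K) :=
  inferInstanceAs (AddCommGroup (compSubmodule s h.1 K))

instance (s : ℝ) (h : Set.Ioi (0 : ℝ)) (K : Set (Eu d)) : Module ℂ (Comp s h K) :=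
  inferInstanceAs (Module ℂ (compSubmodule s h.1 K))

/-- The function on `ℝ^d` underlying an element of `D^{s,h}_K`. -/
def Comp.fn {s : ℝ} {h : Set.Ioi (0 : ℝ)} {K : Set (Eu d)} (f : Comp s h K) : Eu d → ℂ := f.1

/-- The norm `sup_α sup_{x ∈ K} h^{|α|} |∂^α f(x)| / α!^s` of `D^{s,h}_K`. -/
instance (s : ℝ) (h : Set.Ioi (0 : ℝ)) (K : Set (Eu d)) : Norm (Comp s h K) :=
  ⟨fun f => (supENorm s h.1 K f.fn).toReal⟩

theorem Comp.core (s : ℝ) (h : Set.Ioi (0 : ℝ)) (K : Set (Eu d)) :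
    NormedSpace.Core ℂ (Comp s h K) where
  norm_nonneg _ := ENNReal.toReal_nonneg
  norm_smul c f := by
    change (supENorm s h.1 K (c • f.fn)).toReal = ‖c‖ * (supENorm s h.1 K f.fn).toReal
    rw [supENorm_smul s h.1 K c (f := f.fn) f.2.1, ENNReal.toReal_mul, toReal_enorm]
  norm_triangle f g := by
    change (supENorm s h.1 K (f.fn + g.fn)).toReal ≤
      (supENorm s h.1 K f.fn).toReal + (supENorm s h.1 K g.fn).toReal
    rw [← ENNReal.toReal_add (a := supENorm s h.1 K f.fn) (b := supENorm s h.1 K g.fn)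
      f.2.2.2.ne g.2.2.2.ne]
    exact ENNReal.toReal_mono (ENNReal.add_lt_top.2 ⟨f.2.2.2, g.2.2.2⟩).ne
      (supENorm_add_le s h.1 K f.2.1 g.2.1)
  norm_eq_zero_iff f := by
    change (supENorm s h.1 K f.fn).toReal = 0 ↔ f = 0
    constructor
    · intro H
      have H' : supENorm s h.1 K f.fn = 0 :=
        ((ENNReal.toReal_eq_zero_iff _).1 H).resolve_right f.2.2.2.ne
      refine Subtype.ext (funext fun x => ?_)
      change f.fn x = 0
      by_cases hx : x ∈ K
      · have h1 : ENNReal.ofReal (weight s h.1 (0 : Fin d → ℕ)) * ‖pderiv 0 f.fn x‖ₑ ≤ 0 := by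
          rw [← H']
          exact supENorm_ge s h.1 hx f.fn 0
        have h2 := weight_pos (d := d) s h.2 0
        rw [pderiv_zero] at h1
        have h3 := (mul_eq_zero.1 (nonpos_iff_eq_zero.1 h1)).resolve_left (by simpa using h2)
        simpa using h3
      · exact image_eq_zero_of_notMem_tsupport fun hx' => hx (f.2.2.1 hx')
    · rintro rfl
      change (supENorm s h.1 K 0).toReal = 0
      rw [supENorm_zero]; rfl

instance (s : ℝ) (h : Set.Ioi (0 : ℝ)) (K : Set (Eu d)) : NormedAddCommGroup (Comp s h K) :=
  NormedAddCommGroup.ofCore (Comp.core s h K)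

instance (s : ℝ) (h : Set.Ioi (0 : ℝ)) (K : Set (Eu d)) : NormedSpace ℂ (Comp s h K) :=
  NormedSpace.ofCore (Comp.core s h K)

/-- The functions that lie in `D^{s,h}_K` for every `h > 0`. -/
def beurlingCompSubmodule (s : ℝ) (K : Set (Eu d)) : Submodule ℂ (Eu d → ℂ) :=
  ⨅ h : Set.Ioi (0 : ℝ), compSubmodule s h.1 K

/-- The space `D^{(s)}_K`, the projective limit of the spaces `D^{s,h}_K`, as a type. -/
def BeurlingComp (s : ℝ) (K : Set (Eu d)) : Type := beurlingCompSubmodule s K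

instance (s : ℝ) (K : Set (Eu d)) : AddCommGroup (BeurlingComp s K) :=
  inferInstanceAs (AddCommGroup (beurlingCompSubmodule s K))

instance (s : ℝ) (K : Set (Eu d)) : Module ℂ (BeurlingComp s K) :=
  inferInstanceAs (Module ℂ (beurlingCompSubmodule s K))

/-- The function on `ℝ^d` underlying an element of `D^{(s)}_K`. -/
def BeurlingComp.fn {s : ℝ} {K : Set (Eu d)} (f : BeurlingComp s K) : Eu d → ℂ := f.1

/-- The inclusion `D^{(s)}_K → D^{s,h}_K`. -/
def BeurlingComp.incl (s : ℝ) (K : Set (Eu d)) (h : Set.Ioi (0 : ℝ)) :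
    BeurlingComp s K →ₗ[ℂ] Comp s h K :=
  Submodule.inclusion (iInf_le (fun h : Set.Ioi (0 : ℝ) => compSubmodule s h.1 K) h)

/-- The projective limit topology of `D^{(s)}_K`. -/
instance (s : ℝ) (K : Set (Eu d)) : TopologicalSpace (BeurlingComp s K) :=
  ⨅ h : Set.Ioi (0 : ℝ), TopologicalSpace.induced (BeurlingComp.incl s K h) inferInstance

instance (s : ℝ) (K : Set (Eu d)) : IsTopologicalAddGroup (BeurlingComp s K) :=
  topologicalAddGroup_iInf fun h => topologicalAddGroup_induced (BeurlingComp.incl s K h)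

instance (s : ℝ) (K : Set (Eu d)) : ContinuousSMul ℂ (BeurlingComp s K) :=
  continuousSMul_iInf fun h => continuousSMul_induced (BeurlingComp.incl s K h)

/-! ### Functions on an open set -/

/-- The extension by zero of a function on `U` to `ℝ^d`. -/
def zeroExt (U : Opens (Eu d)) (φ : U → ℂ) (x : Eu d) : ℂ :=
  open scoped Classical in if hx : x ∈ U then φ ⟨x, hx⟩ else 0

theorem zeroExt_add (U : Opens (Eu d)) (φ ψ : U → ℂ) :
    zeroExt U (φ + ψ) = zeroExt U φ + zeroExt U ψ := by
  funext x; by_cases hx : x ∈ U <;> simp [zeroExt, hx]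

theorem zeroExt_smul (U : Opens (Eu d)) (c : ℂ) (φ : U → ℂ) :
    zeroExt U (c • φ) = c • zeroExt U φ := by
  funext x; by_cases hx : x ∈ U <;> simp [zeroExt, hx]

theorem zeroExt_zero (U : Opens (Eu d)) : zeroExt U 0 = 0 := by
  funext x; simp [zeroExt]

/-- `φ ∈ C^∞(U)`. (At the points of the open set `U` the values that `zeroExt` takes off `U` are
irrelevant for derivatives.) -/
def IsSmooth (U : Opens (Eu d)) (φ : U → ℂ) : Prop := ContDiffOn ℝ ∞ (zeroExt U φ) U

theorem IsSmooth.contDiffAt {U : Opens (Eu d)} {φ : U → ℂ} (hφ : IsSmooth U φ) {x : Eu d}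
    (hx : x ∈ U) : ContDiffAt ℝ ∞ (zeroExt U φ) x :=
  ContDiffOn.contDiffAt hφ (U.isOpen.mem_nhds hx)

theorem IsSmooth.add {U : Opens (Eu d)} {φ ψ : U → ℂ} (hφ : IsSmooth U φ) (hψ : IsSmooth U ψ) :
    IsSmooth U (φ + ψ) := by
  unfold IsSmooth; rw [zeroExt_add]; exact ContDiffOn.add hφ hψ

theorem IsSmooth.smul {U : Opens (Eu d)} {φ : U → ℂ} (hφ : IsSmooth U φ) (c : ℂ) :
    IsSmooth U (c • φ) := by
  unfold IsSmooth; rw [zeroExt_smul]; exact ContDiffOn.const_smul c hφ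

theorem IsSmooth.zero (U : Opens (Eu d)) : IsSmooth U 0 := by
  unfold IsSmooth; rw [zeroExt_zero]; exact contDiffOn_const

/-- `‖∂^α φ‖_{L^p(U)}`. -/
def derivENorm (p : ENNReal) (U : Opens (Eu d)) (φ : U → ℂ) (α : Fin d → ℕ) : ENNReal :=
  eLpNorm (pderiv α (zeroExt U φ)) p (volume.restrict (U : Set (Eu d)))

theorem pderiv_continuousOn {U : Opens (Eu d)} {φ : U → ℂ} (hφ : IsSmooth U φ)
    (α : Fin d → ℕ) : ContinuousOn (pderiv α (zeroExt U φ)) U := by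
  intro x hx
  have h1 : ContinuousAt (iteratedFDeriv ℝ (dirs α).length (zeroExt U φ)) x := by
    have := (hφ.contDiffAt hx).iteratedFDeriv_right (m := 0) (i := (dirs α).length)
      (by simp; exact_mod_cast le_top)
    exact this.continuousAt
  have h2 : ContinuousAt (pderiv α (zeroExt U φ)) x :=
    h1.eval_const (x := fun i => EuclideanSpace.single ((dirs α).get i) (1 : ℝ))
  exact h2.continuousWithinAt

theorem pderiv_aestronglyMeasurable {U : Opens (Eu d)} {φ : U → ℂ} (hφ : IsSmooth U φ)
    (α : Fin d → ℕ) :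
    AEStronglyMeasurable (pderiv α (zeroExt U φ)) (volume.restrict (U : Set (Eu d))) :=
  (pderiv_continuousOn hφ α).aestronglyMeasurable U.isOpen.measurableSet

theorem derivENorm_add_le {p : ENNReal} (hp : 1 ≤ p) {U : Opens (Eu d)} {φ ψ : U → ℂ}
    (hφ : IsSmooth U φ) (hψ : IsSmooth U ψ) (α : Fin d → ℕ) :
    derivENorm p U (φ + ψ) α ≤ derivENorm p U φ α + derivENorm p U ψ α := by
  have h : derivENorm p U (φ + ψ) α =
      eLpNorm (pderiv α (zeroExt U φ) + pderiv α (zeroExt U ψ)) p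
        (volume.restrict (U : Set (Eu d))) := by
    refine eLpNorm_congr_ae ?_
    filter_upwards [ae_restrict_mem U.isOpen.measurableSet] with x hx
    rw [zeroExt_add, pderiv_add α (hφ.contDiffAt hx) (hψ.contDiffAt hx)]
    rfl
  rw [h]
  exact eLpNorm_add_le (pderiv_aestronglyMeasurable hφ α) (pderiv_aestronglyMeasurable hψ α) hp

theorem derivENorm_smul (p : ENNReal) {U : Opens (Eu d)} {φ : U → ℂ}
    (hφ : IsSmooth U φ) (c : ℂ) (α : Fin d → ℕ) :
    derivENorm p U (c • φ) α = ‖c‖ₑ * derivENorm p U φ α := by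
  have h : derivENorm p U (c • φ) α =
      eLpNorm (c • pderiv α (zeroExt U φ)) p (volume.restrict (U : Set (Eu d))) := by
    refine eLpNorm_congr_ae ?_
    filter_upwards [ae_restrict_mem U.isOpen.measurableSet] with x hx
    rw [zeroExt_smul, pderiv_smul α c (hφ.contDiffAt hx)]
    rfl
  rw [h, eLpNorm_const_smul]
  rfl

/-! ### The spaces `D^s_{L^p,h}(U)` and `D^{(s)}_{L^p,h}(U)` -/

/-- `(∑_α (h^{|α|} ‖∂^α φ‖_{L^p(U)} / α!^s)^p)^{1/p}` for `p < ∞`, and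
`sup_α h^{|α|} ‖∂^α φ‖_{L^∞(U)} / α!^s` for `p = ∞`. -/
def lpENorm (s : ℝ) (p : ENNReal) (h : ℝ) (U : Opens (Eu d)) (φ : U → ℂ) : ENNReal :=
  if p = ⊤ then ⨆ α : Fin d → ℕ, ENNReal.ofReal (weight s h α) * derivENorm p U φ α
  else (∑' α : Fin d → ℕ,
    (ENNReal.ofReal (weight s h α) * derivENorm p U φ α) ^ p.toReal) ^ (1 / p.toReal)

theorem lpENorm_add_le (s : ℝ) {p : ENNReal} (hp : 1 ≤ p) (h : ℝ) {U : Opens (Eu d)}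
    {φ ψ : U → ℂ} (hφ : IsSmooth U φ) (hψ : IsSmooth U ψ) :
    lpENorm s p h U (φ + ψ) ≤ lpENorm s p h U φ + lpENorm s p h U ψ := by
  have key : ∀ α, ENNReal.ofReal (weight s h α) * derivENorm p U (φ + ψ) α ≤
      ENNReal.ofReal (weight s h α) * derivENorm p U φ α +
        ENNReal.ofReal (weight s h α) * derivENorm p U ψ α := fun α => by
    rw [← mul_add]; gcongr; exact derivENorm_add_le hp hφ hψ α
  unfold lpENorm
  split_ifs with hpt
  · refine iSup_le fun α => (key α).trans (add_le_add ?_ ?_)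
    · exact le_iSup (fun α => ENNReal.ofReal (weight s h α) * derivENorm p U φ α) α
    · exact le_iSup (fun α => ENNReal.ofReal (weight s h α) * derivENorm p U ψ α) α
  · have hp1 : 1 ≤ p.toReal := by
      rw [← ENNReal.toReal_one]; exact ENNReal.toReal_mono hpt hp
    calc _ ≤ (∑' α : Fin d → ℕ, (ENNReal.ofReal (weight s h α) * derivENorm p U φ α +
          ENNReal.ofReal (weight s h α) * derivENorm p U ψ α) ^ p.toReal) ^ (1 / p.toReal) := by
          gcongr with α; exact key α
      _ ≤ _ := by
          have := ENNReal.lintegral_Lp_add_le (μ := Measure.count)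
            (f := fun α : Fin d → ℕ => ENNReal.ofReal (weight s h α) * derivENorm p U φ α)
            (g := fun α : Fin d → ℕ => ENNReal.ofReal (weight s h α) * derivENorm p U ψ α)
            (Measurable.of_discrete.aemeasurable) (Measurable.of_discrete.aemeasurable) hp1
          simpa [lintegral_count] using this

theorem lpENorm_smul (s : ℝ) {p : ENNReal} (hp : 1 ≤ p) (h : ℝ) {U : Opens (Eu d)}
    {φ : U → ℂ} (hφ : IsSmooth U φ) (c : ℂ) :
    lpENorm s p h U (c • φ) = ‖c‖ₑ * lpENorm s p h U φ := by
  have key : ∀ α, ENNReal.ofReal (weight s h α) * derivENorm p U (c • φ) α =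
      ‖c‖ₑ * (ENNReal.ofReal (weight s h α) * derivENorm p U φ α) := fun α => by
    rw [derivENorm_smul p hφ c α]; ring
  simp only [lpENorm, key]
  split_ifs with hpt
  · rw [ENNReal.mul_iSup]
  · have hp1 : 1 ≤ p.toReal := by
      rw [← ENNReal.toReal_one]; exact ENNReal.toReal_mono hpt hp
    have hp0 : p.toReal ≠ 0 := by linarith
    simp only [ENNReal.mul_rpow_of_nonneg _ _ (zero_le_one.trans hp1), ENNReal.tsum_mul_left]
    rw [ENNReal.mul_rpow_of_nonneg _ _ (by positivity), ← ENNReal.rpow_mul,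
      mul_one_div_cancel hp0, ENNReal.rpow_one]

theorem lpENorm_zero (s : ℝ) {p : ENNReal} (hp : 1 ≤ p) (h : ℝ) (U : Opens (Eu d)) :
    lpENorm s p h U 0 = 0 := by
  have := lpENorm_smul s hp h (IsSmooth.zero U) 0
  simpa using this

theorem derivENorm_eq_zero {s : ℝ} {p : ENNReal} (hp : 1 ≤ p) {h : ℝ} (hh : 0 < h)
    {U : Opens (Eu d)} {φ : U → ℂ} (H : lpENorm s p h U φ = 0) (α : Fin d → ℕ) :
    derivENorm p U φ α = 0 := by
  have hw := weight_pos s hh α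
  have key : ENNReal.ofReal (weight s h α) * derivENorm p U φ α = 0 := by
    unfold lpENorm at H
    split_ifs at H with hpt
    · exact (ENNReal.iSup_eq_zero.1 H) α
    · have hp1 : 1 ≤ p.toReal := by
        rw [← ENNReal.toReal_one]; exact ENNReal.toReal_mono hpt hp
      have hp0 : 0 < p.toReal := by linarith
      rw [ENNReal.rpow_eq_zero_iff_of_pos (by positivity), ENNReal.tsum_eq_zero] at H
      exact (ENNReal.rpow_eq_zero_iff_of_pos hp0).1 (H α)
  exact (mul_eq_zero.1 key).resolve_left (by simpa using hw)

theorem eq_zero_of_lpENorm {s : ℝ} {p : ENNReal} (hp : 1 ≤ p) {h : ℝ} (hh : 0 < h)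
    {U : Opens (Eu d)} {φ : U → ℂ} (hφ : IsSmooth U φ) (H : lpENorm s p h U φ = 0) : φ = 0 := by
  have h0 := derivENorm_eq_zero hp hh H 0
  unfold derivENorm at h0
  rw [eLpNorm_eq_zero_iff (pderiv_aestronglyMeasurable hφ 0)
    (zero_lt_one.trans_le hp).ne'] at h0
  have h1 := Measure.eqOn_open_of_ae_eq h0 U.isOpen (pderiv_continuousOn hφ 0) continuousOn_const
  rw [pderiv_zero] at h1
  funext x
  simpa [zeroExt] using h1 x.2

/-- The functions in `C^∞(U)` with finite `D^s_{L^p,h}(U)`-norm. -/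
def lpSubmodule (s : ℝ) (p : ENNReal) [hp : Fact (1 ≤ p)] (h : ℝ) (U : Opens (Eu d)) :
    Submodule ℂ (U → ℂ) where
  carrier := {φ | IsSmooth U φ ∧ lpENorm s p h U φ < ⊤}
  zero_mem' := ⟨IsSmooth.zero U, by
    change lpENorm s p h U 0 < ⊤
    rw [lpENorm_zero s hp.out]; exact ENNReal.zero_lt_top⟩
  add_mem' := by
    rintro φ ψ ⟨hφ, hφ'⟩ ⟨hψ, hψ'⟩
    exact ⟨hφ.add hψ, (lpENorm_add_le s hp.out h hφ hψ).trans_lt (ENNReal.add_lt_top.2 ⟨hφ', hψ'⟩)⟩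
  smul_mem' := by
    rintro c φ ⟨hφ, hφ'⟩
    refine ⟨hφ.smul c, ?_⟩
    rw [lpENorm_smul s hp.out h hφ]
    exact ENNReal.mul_lt_top enorm_lt_top hφ'

section Lp

variable (s : ℝ) (p : ENNReal) [hp : Fact (1 ≤ p)] (h : Set.Ioi (0 : ℝ)) (U : Opens (Eu d))

/-- The space `D^s_{L^p,h}(U)`, as a type. -/
def LpSpace : Type := lpSubmodule s p h.1 U

instance : AddCommGroup (LpSpace s p h U) :=
  inferInstanceAs (AddCommGroup (lpSubmodule s p h.1 U))

instance : Module ℂ (LpSpace s p h U) :=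
  inferInstanceAs (Module ℂ (lpSubmodule s p h.1 U))

variable {s p h U} in
/-- The function on `U` underlying an element of `D^s_{L^p,h}(U)`. -/
def LpSpace.fn (φ : LpSpace s p h U) : U → ℂ := φ.1

/-- The forgetful linear map from `D^s_{L^p,h}(U)` to the functions on `U`. -/
def LpSpace.fnₗ : LpSpace s p h U →ₗ[ℂ] (U → ℂ) := (lpSubmodule s p h.1 U).subtype

instance : Norm (LpSpace s p h U) := ⟨fun φ => (lpENorm s p h.1 U φ.fn).toReal⟩

theorem LpSpace.core : NormedSpace.Core ℂ (LpSpace s p h U) where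
  norm_nonneg _ := ENNReal.toReal_nonneg
  norm_smul c φ := by
    change (lpENorm s p h.1 U (c • φ.fn)).toReal = ‖c‖ * (lpENorm s p h.1 U φ.fn).toReal
    rw [lpENorm_smul s hp.out h.1 (φ := φ.fn) φ.2.1, ENNReal.toReal_mul, toReal_enorm]
  norm_triangle φ ψ := by
    change (lpENorm s p h.1 U (φ.fn + ψ.fn)).toReal ≤
      (lpENorm s p h.1 U φ.fn).toReal + (lpENorm s p h.1 U ψ.fn).toReal
    rw [← ENNReal.toReal_add (a := lpENorm s p h.1 U φ.fn) (b := lpENorm s p h.1 U ψ.fn)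
      φ.2.2.ne ψ.2.2.ne]
    exact ENNReal.toReal_mono (ENNReal.add_lt_top.2 ⟨φ.2.2, ψ.2.2⟩).ne
      (lpENorm_add_le s hp.out h.1 φ.2.1 ψ.2.1)
  norm_eq_zero_iff φ := by
    change (lpENorm s p h.1 U φ.fn).toReal = 0 ↔ φ = 0
    constructor
    · intro H
      have H' : lpENorm s p h.1 U φ.fn = 0 :=
        ((ENNReal.toReal_eq_zero_iff _).1 H).resolve_right φ.2.2.ne
      exact Subtype.ext (eq_zero_of_lpENorm hp.out h.2 φ.2.1 H')
    · rintro rfl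
      change (lpENorm s p h.1 U 0).toReal = 0
      rw [lpENorm_zero s hp.out]; rfl

instance : NormedAddCommGroup (LpSpace s p h U) :=
  NormedAddCommGroup.ofCore (LpSpace.core s p h U)

instance : NormedSpace ℂ (LpSpace s p h U) :=
  NormedSpace.ofCore (LpSpace.core s p h U)

end Lp

theorem zeroExt_mem_mono {s : ℝ} {K L : Set (Eu d)} (hKL : K ⊆ L) {f : Eu d → ℂ}
    (hf : f ∈ beurlingCompSubmodule s K) : f ∈ beurlingCompSubmodule s L := by
  simp only [beurlingCompSubmodule, Submodule.mem_iInf] at hf ⊢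
  intro h
  obtain ⟨h1, h2, h3⟩ := hf h
  refine ⟨h1, h2.trans hKL, lt_of_le_of_lt ?_ h3⟩
  refine iSup_le fun α => iSup₂_le fun x _ => ?_
  by_cases hxK : x ∈ K
  · exact supENorm_ge s h.1 hxK f α
  · have hz : iteratedFDeriv ℝ (dirs α).length f x = 0 :=
      image_eq_zero_of_notMem_tsupport fun hx =>
        hxK (h2 (tsupport_iteratedFDeriv_subset _ hx))
    simp [pderiv, hz]

/-- The space `D^{(s)}(U)`, the union of the spaces `D^{(s)}_K` over the compact sets `K ⊆ U`,
as a space of functions on `U`. -/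
def testSubmodule (s : ℝ) (U : Opens (Eu d)) : Submodule ℂ (U → ℂ) where
  carrier := {φ | ∃ K : Set (Eu d), IsCompact K ∧ K ⊆ U ∧
    zeroExt U φ ∈ beurlingCompSubmodule s K}
  zero_mem' := ⟨∅, isCompact_empty, Set.empty_subset _, by
    rw [zeroExt_zero]; exact Submodule.zero_mem _⟩
  add_mem' := by
    rintro φ ψ ⟨K, hK, hKU, hφ⟩ ⟨L, hL, hLU, hψ⟩
    refine ⟨K ∪ L, hK.union hL, Set.union_subset hKU hLU, ?_⟩
    rw [zeroExt_add]
    exact Submodule.add_mem _ (zeroExt_mem_mono Set.subset_union_left hφ)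
      (zeroExt_mem_mono Set.subset_union_right hψ)
  smul_mem' := by
    rintro c φ ⟨K, hK, hKU, hφ⟩
    refine ⟨K, hK, hKU, ?_⟩
    rw [zeroExt_smul]
    exact Submodule.smul_mem _ c hφ

/-- The space `D^{(s)}_{L^p,h}(U)`: the closure of `D^{(s)}(U)` in `D^s_{L^p,h}(U)`, with the
induced norm. -/
def LpClosure (s : ℝ) (p : ENNReal) [Fact (1 ≤ p)] (h : Set.Ioi (0 : ℝ)) (U : Opens (Eu d)) :
    Submodule ℂ (LpSpace s p h U) :=
  ((testSubmodule s U).comap (LpSpace.fnₗ s p h U)).topologicalClosure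

/-! ### The spaces `B^{(s)}_{L^p}(U)` and `Ḃ^{(s)}(U)` -/

section Beurling

variable (s : ℝ) (p : ENNReal) [hp : Fact (1 ≤ p)] (U : Opens (Eu d))

/-- The functions that lie in `D^s_{L^p,h}(U)` for every `h > 0`. -/
def beurlingSubmodule : Submodule ℂ (U → ℂ) := ⨅ h : Set.Ioi (0 : ℝ), lpSubmodule s p h.1 U

/-- The space `B^{(s)}_{L^p}(U)`, the projective limit of the spaces `D^s_{L^p,h}(U)`,
as a type. -/
def Beurling : Type := beurlingSubmodule s p U

instance : AddCommGroup (Beurling s p U) := inferInstanceAs (AddCommGroup (beurlingSubmodule s p U))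

instance : Module ℂ (Beurling s p U) := inferInstanceAs (Module ℂ (beurlingSubmodule s p U))

variable {s p U} in
/-- The function on `U` underlying an element of `B^{(s)}_{L^p}(U)`. -/
def Beurling.fn (φ : Beurling s p U) : U → ℂ := φ.1

/-- The forgetful linear map from `B^{(s)}_{L^p}(U)` to the functions on `U`. -/
def Beurling.fnₗ : Beurling s p U →ₗ[ℂ] (U → ℂ) := (beurlingSubmodule s p U).subtype

/-- The inclusion `B^{(s)}_{L^p}(U) → D^s_{L^p,h}(U)`. -/
def Beurling.incl (h : Set.Ioi (0 : ℝ)) : Beurling s p U →ₗ[ℂ] LpSpace s p h U :=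
  Submodule.inclusion (iInf_le (fun h : Set.Ioi (0 : ℝ) => lpSubmodule s p h.1 U) h)

/-- The projective limit topology of `B^{(s)}_{L^p}(U)`. -/
instance : TopologicalSpace (Beurling s p U) :=
  ⨅ h : Set.Ioi (0 : ℝ), TopologicalSpace.induced (Beurling.incl s p U h) inferInstance

instance : IsTopologicalAddGroup (Beurling s p U) :=
  topologicalAddGroup_iInf fun h => topologicalAddGroup_induced (Beurling.incl s p U h)

instance : ContinuousSMul ℂ (Beurling s p U) :=
  continuousSMul_iInf fun h => continuousSMul_induced (Beurling.incl s p U h)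

end Beurling

/-- The space `Ḃ^{(s)}(U)`: the closure of `D^{(s)}(U)` in `B^{(s)}_{L^∞}(U)`, with the induced
topology. -/
def BDot (s : ℝ) (U : Opens (Eu d)) : Submodule ℂ (Beurling s ⊤ U) :=
  ((testSubmodule s U).comap (Beurling.fnₗ s ⊤ U)).topologicalClosure

end Gevrey

universe u

/-! ### Projective limits, (FS)-spaces and nuclear spaces -/

/-- `E`, with the continuous linear maps `π i : E → X i`, is the projective limit (as a topological
vector space) of the projective system `u i j : X j → X i`, `i ≤ j`: the `π i` identify `E`, with
its topology, with the space of threads in the product of the `X i`. -/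
structure IsTVSProjectiveLimit {ι : Type*} [Preorder ι] {E : Type*} [AddCommGroup E] [Module ℂ E]
    [TopologicalSpace E] {X : ι → Type*} [∀ i, NormedAddCommGroup (X i)]
    [∀ i, NormedSpace ℂ (X i)] (u : ∀ i j, i ≤ j → (X j →L[ℂ] X i)) (π : ∀ i, E →L[ℂ] X i) :
    Prop where
  link_refl : ∀ i x, u i i le_rfl x = x
  link_trans : ∀ i j k (hij : i ≤ j) (hjk : j ≤ k) x, u i j hij (u j k hjk x) = u i k (hij.trans hjk) x
  isEmbedding : IsEmbedding fun (x : E) (i : ι) => π i x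
  range_eq : (Set.range fun (x : E) (i : ι) => π i x) =
    {y | ∀ i j (hij : i ≤ j), u i j hij (y j) = y i}

/-- An (FS)-space: a projective limit of a sequence of Banach spaces with compact linking maps. -/
def IsFSSpace (E : Type u) [AddCommGroup E] [Module ℂ E] [TopologicalSpace E] : Prop :=
  ∃ (X : ℕ → Type u) (_ : ∀ n, NormedAddCommGroup (X n)) (_ : ∀ n, NormedSpace ℂ (X n))
    (u : ∀ m n, m ≤ n → (X n →L[ℂ] X m)) (π : ∀ n, E →L[ℂ] X n),
    (∀ n, CompleteSpace (X n)) ∧ IsTVSProjectiveLimit u π ∧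
      ∀ m n (hmn : m < n), IsCompactOperator (u m n hmn.le)

/-- The space `E` with the single seminorm `q`. -/
def SeminormSpace {E : Type*} [AddCommGroup E] [Module ℂ E] (_ : Seminorm ℂ E) : Type _ := E

section Nuclear

variable {E : Type*} [AddCommGroup E] [Module ℂ E]

instance (q : Seminorm ℂ E) : SeminormedAddCommGroup (SeminormSpace q) :=
  q.toAddGroupSeminorm.toSeminormedAddCommGroup

instance (q : Seminorm ℂ E) : Module ℂ (SeminormSpace q) := inferInstanceAs (Module ℂ E)

instance (q : Seminorm ℂ E) : NormedSpace ℂ (SeminormSpace q) :=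
  ⟨fun c x => (map_smul_eq_mul q c x).le⟩

/-- The local Banach space of the seminorm `q`: the (Hausdorff) completion of `(E, q)`, that is,
the completion of the normed space `E / ker q`. -/
abbrev LocalBanach (q : Seminorm ℂ E) : Type _ := UniformSpace.Completion (SeminormSpace q)

/-- The canonical map from `E` to the local Banach space of `q`. -/
def toLocalBanach (q : Seminorm ℂ E) : E →ₗ[ℂ] LocalBanach q :=
  (UniformSpace.Completion.toComplL (𝕜 := ℂ) (E := SeminormSpace q)).toLinearMap

/-- A linear map `T` from a locally convex space to a Banach space is nuclear if
`T x = ∑ c_n f_n(x) y_n` with `∑ |c_n| < ∞`, an equicontinuous sequence of linear functionals `f_n`,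
and `y_n` in the unit ball. -/
def IsNuclearMap [TopologicalSpace E] {F : Type*} [NormedAddCommGroup F] [NormedSpace ℂ F]
    (T : E →ₗ[ℂ] F) : Prop :=
  ∃ (c : ℕ → ℂ) (f : ℕ → E →ₗ[ℂ] ℂ) (y : ℕ → F), (Summable fun n => ‖c n‖) ∧
    (∃ r : Seminorm ℂ E, Continuous r ∧ ∀ n x, ‖f n x‖ ≤ r x) ∧ (∀ n, ‖y n‖ ≤ 1) ∧
    ∀ x, HasSum (fun n => (c n * f n x) • y n) (T x)

/-- A nuclear space: a Hausdorff locally convex space `E` such that for every continuous seminorm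
`q` the canonical map from `E` to the local Banach space of `q` is nuclear. -/
def IsNuclearSpace (E : Type*) [AddCommGroup E] [Module ℂ E] [TopologicalSpace E] : Prop :=
  T2Space E ∧ IsTopologicalAddGroup E ∧ ContinuousSMul ℂ E ∧
  (∀ V ∈ 𝓝 (0 : E), ∃ q : Seminorm ℂ E, Continuous q ∧ q.ball 0 1 ⊆ V) ∧
  ∀ q : Seminorm ℂ E, Continuous q → IsNuclearMap (toLocalBanach q)

end Nuclear

end

noncomputable section

namespace Gevrey

/-! The proof rests on two estimates: a Sobolev inequality for test functions and a sampling
inequality for `D^{s,h}_K`.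

Extension. Integrating once in each coordinate bounds `|∂^α φ|` on all of `ℝ^d`, for a test function
`φ`, by the `L¹` norm of `∂^{α+(1,…,1)} φ` (`enorm_pderiv_le_lintegral`). Hölder on the bounded set
`U` bounds this by `C_α` times the norm of `D^s_{L^p,h}(U)` (`exists_pderiv_bound`); no uniformity
in `α` is needed. Hence test functions converging in that norm converge uniformly on `ℝ^d` with
every derivative, and their limit is smooth, vanishes off `U` and agrees with `φ` on `U`
(`contDiff_zeroExt`). For `p = ∞` the essential supremum over `U` of a continuous function is its
supremum over the closure, so extension by zero is isometric. Its range is closed because uniform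
limits still vanish off `U` (`isClosed_range_extComp`).

Projective limits. The norms increase with `h`, so a neighbourhood in the limit topology contains a
ball of one single norm. Thus a function that lies in the closure of the test functions for each `h`
separately lies in `Ḃ^{(s)}(U)` (`mem_BDot_of_forall`). This gives the projective limit
representation and carries the closed range at each `h` over to the limit.

Compactness and nuclearity. One more derivative costs a factor `(α_j+1)^s / h`, which grows at most
geometrically in `|α|`. With `N₀ A^{|α|}` grid points per axis, the mean value inequality makes the
weighted error between a point and its nearest grid point at most half the norm, so the norm is at
most twice the supremum of the weighted grid values (`Comp.norm_le_of_grid`). Passing from `h₁` to a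
smaller `h` multiplies the bound on samples of order `|α|` by `(h/h₁)^{|α|}`. On the unit ball all
but finitely many samples are therefore uniformly small, which gives compact linking maps. If `h₁`
is so large that the gain beats the number `N₀^d A^{d|α|}` of grid points, the samples are summable;
every continuous seminorm then factors through `ℓ²` with a summable expansion, which is nuclearity
(`isNuclearMap_toLocalBanach`). -/

variable {d : ℕ}

/-! ### Calculus of partial derivatives indexed by multi-indices. -/

/-- The `j`-th standard basis vector of `ℝ^d`. -/
def basisVec (j : Fin d) : Eu d := EuclideanSpace.single j (1 : ℝ)

/-- The iterated directional derivative along the basis vectors listed in `l`. -/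
def listDeriv : List (Fin d) → (Eu d → ℂ) → Eu d → ℂ
  | [], f => f
  | j :: l, f => fun x => fderiv ℝ (listDeriv l f) x (basisVec j)

theorem contDiff_fderiv_apply {f : Eu d → ℂ} (hf : ContDiff ℝ ∞ f) (v : Eu d) :
    ContDiff ℝ ∞ fun x => fderiv ℝ f x v :=
  (hf.fderiv_right (m := ∞) (by simp)).clm_apply contDiff_const

theorem contDiff_listDeriv {f : Eu d → ℂ} (hf : ContDiff ℝ ∞ f) (l : List (Fin d)) :
    ContDiff ℝ ∞ (listDeriv l f) := by
  induction l with
  | nil => exact hf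
  | cons j l ih => exact contDiff_fderiv_apply ih _

theorem iteratedFDeriv_eq_listDeriv {f : Eu d → ℂ} (hf : ContDiff ℝ ∞ f) (l : List (Fin d))
    (x : Eu d) :
    iteratedFDeriv ℝ l.length f x (fun i => EuclideanSpace.single (l.get i) (1 : ℝ)) =
      listDeriv l f x := by
  induction l generalizing x with
  | nil => simp [listDeriv]
  | cons j l ih =>
    have h1 : listDeriv l f = fun y => iteratedFDeriv ℝ l.length f y
        (fun i => EuclideanSpace.single (l.get i) (1 : ℝ)) := funext fun y => (ih y).symm
    have h2 : DifferentiableAt ℝ (iteratedFDeriv ℝ l.length f) x :=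
      (hf.differentiable_iteratedFDeriv (by exact_mod_cast ENat.natCast_lt_top _)) x
    simp only [listDeriv]
    rw [h1, fderiv_continuousMultilinear_apply_const_apply h2]
    exact iteratedFDeriv_succ_apply_left _

theorem fderiv_apply_comm {f : Eu d → ℂ} (hf : ContDiff ℝ ∞ f) (v w x : Eu d) :
    fderiv ℝ (fun y => fderiv ℝ f y v) x w = fderiv ℝ (fun y => fderiv ℝ f y w) x v := by
  have hd : DifferentiableAt ℝ (fderiv ℝ f) x :=
    (hf.fderiv_right (m := ∞) (by simp)).differentiable (by simp) x
  have hs : IsSymmSndFDerivAt ℝ f x :=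
    hf.contDiffAt.isSymmSndFDerivAt
      (by simpa using WithTop.coe_le_coe.2 (le_top : (2 : ℕ∞) ≤ ⊤))
  rw [fderiv_clm_apply hd (differentiableAt_const v), fderiv_clm_apply hd (differentiableAt_const w)]
  simpa using hs w v

/-- `pderiv` fixes one order of differentiation. Symmetry of second derivatives removes this choice,
so only the multiplicities of the directions matter. -/
theorem listDeriv_perm {f : Eu d → ℂ} (hf : ContDiff ℝ ∞ f) {l l' : List (Fin d)}
    (h : l.Perm l') : listDeriv l f = listDeriv l' f := by
  induction h with
  | nil => rfl
  | cons j _ ih => simp only [listDeriv, ih]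
  | swap i j l =>
    funext x
    exact fderiv_apply_comm (contDiff_listDeriv hf l) _ _ x
  | trans _ _ h1 h2 => exact h1.trans h2

theorem pderiv_eq_listDeriv {f : Eu d → ℂ} (hf : ContDiff ℝ ∞ f) (α : Fin d → ℕ) :
    pderiv α f = listDeriv (dirs α) f :=
  funext fun x => iteratedFDeriv_eq_listDeriv hf (dirs α) x

theorem contDiff_pderiv {f : Eu d → ℂ} (hf : ContDiff ℝ ∞ f) (α : Fin d → ℕ) :
    ContDiff ℝ ∞ (pderiv α f) := by
  rw [pderiv_eq_listDeriv hf]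
  exact contDiff_listDeriv hf _

theorem listDeriv_eq_pderiv {f : Eu d → ℂ} (hf : ContDiff ℝ ∞ f) (l : List (Fin d)) :
    listDeriv l f = pderiv (fun j => l.count j) f := by
  rw [pderiv_eq_listDeriv hf]
  refine listDeriv_perm hf (List.perm_iff_count.2 fun j => ?_)
  rw [count_dirs]

theorem fderiv_pderiv {f : Eu d → ℂ} (hf : ContDiff ℝ ∞ f) (α : Fin d → ℕ) (j : Fin d)
    (x : Eu d) : fderiv ℝ (pderiv α f) x (basisVec j) = pderiv (α + Pi.single j 1) f x := by
  rw [pderiv_eq_listDeriv hf, pderiv_eq_listDeriv hf]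
  change listDeriv (j :: dirs α) f x = _
  refine congrFun (listDeriv_perm hf (List.perm_iff_count.2 fun i => ?_)) x
  rw [count_dirs, List.count_cons, count_dirs]
  by_cases h : i = j
  · subst h; simp
  · simp [h, Ne.symm h]

theorem sum_basisVec (v : Eu d) : ∑ j, v j • basisVec j = v := by
  have := (EuclideanSpace.basisFun (Fin d) ℝ).sum_repr v
  simpa [basisVec] using this

theorem norm_apply_le (v : Eu d) (j : Fin d) : |v j| ≤ ‖v‖ := by
  simpa using PiLp.norm_apply_le v j

/-- The norm of a multilinear map is controlled by its values at the basis vectors. -/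
theorem norm_multilinear_le {k : ℕ} (m : ContinuousMultilinearMap ℝ (fun _ : Fin k => Eu d) ℂ) :
    ‖m‖ ≤ ∑ r : Fin k → Fin d, ‖m fun i => basisVec (r i)‖ := by
  refine ContinuousMultilinearMap.opNorm_le_bound (by positivity) fun v => ?_
  have h1 : m v = ∑ r : Fin k → Fin d, m fun i => v i (r i) • basisVec (r i) := by
    have := m.map_sum (α := fun _ => Fin d) (g := fun i j => v i j • basisVec j)
    simp only [sum_basisVec] at this
    exact this
  rw [h1, Finset.sum_mul]
  refine (norm_sum_le _ _).trans (Finset.sum_le_sum fun r _ => ?_)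
  rw [m.map_smul_univ, norm_smul, mul_comm]
  gcongr
  rw [norm_prod]
  gcongr with i
  exact norm_apply_le _ _

theorem norm_iteratedFDeriv_le {f : Eu d → ℂ} (hf : ContDiff ℝ ∞ f) (k : ℕ) (x : Eu d) :
    ‖iteratedFDeriv ℝ k f x‖ ≤
      ∑ r : Fin k → Fin d, ‖pderiv (fun j => (List.ofFn r).count j) f x‖ := by
  refine (norm_multilinear_le _).trans (Finset.sum_le_sum fun r _ => le_of_eq ?_)
  rw [← listDeriv_eq_pderiv hf, ← iteratedFDeriv_eq_listDeriv hf]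
  -- The length of `List.ofFn r` is only propositionally `k`, so the identity is stated for every `n
  -- = k`.
  have key : ∀ (n : ℕ) (hn : n = k) (g : Fin n → Fin d), (∀ i, g i = r (Fin.cast hn i)) →
      iteratedFDeriv ℝ k f x (fun i => basisVec (r i)) =
      iteratedFDeriv ℝ n f x (fun i => EuclideanSpace.single (g i) (1 : ℝ)) := by
    rintro n rfl g hg
    congr 1
    funext i
    rw [hg]; rfl
  rw [key (List.ofFn r).length (by simp) (List.ofFn r).get (fun i => by simp; rfl)]

theorem norm_fderiv_le {f : Eu d → ℂ} (x : Eu d) :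
    ‖fderiv ℝ f x‖ ≤ ∑ j, ‖fderiv ℝ f x (basisVec j)‖ := by
  refine ContinuousLinearMap.opNorm_le_bound _ (by positivity) fun v => ?_
  conv_lhs => rw [← sum_basisVec v, map_sum]
  rw [Finset.sum_mul]
  refine (norm_sum_le _ _).trans (Finset.sum_le_sum fun j _ => ?_)
  rw [map_smul, norm_smul, mul_comm]
  gcongr
  exact norm_apply_le _ _

/-- Mean value inequality for partial derivatives. -/
theorem norm_pderiv_sub_le {f : Eu d → ℂ} (hf : ContDiff ℝ ∞ f) (α : Fin d → ℕ) {C : ℝ}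
    (hC : ∀ j x, ‖pderiv (α + Pi.single j 1) f x‖ ≤ C) (x y : Eu d) :
    ‖pderiv α f x - pderiv α f y‖ ≤ d * C * ‖x - y‖ := by
  refine Convex.norm_image_sub_le_of_norm_fderiv_le (s := Set.univ) (𝕜 := ℝ)
    (fun z _ => (contDiff_pderiv hf α).differentiable (by simp) z) (fun z _ => ?_) convex_univ
    trivial trivial
  refine (norm_fderiv_le z).trans ?_
  calc ∑ j, ‖fderiv ℝ (pderiv α f) z (basisVec j)‖ ≤ ∑ _j : Fin d, C :=
        Finset.sum_le_sum fun j _ => by rw [fderiv_pderiv hf]; exact hC j z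
    _ = d * C := by simp

theorem pderiv_eq_zero_of_notMem_tsupport {f : Eu d → ℂ} {x : Eu d} (hx : x ∉ tsupport f)
    (α : Fin d → ℕ) : pderiv α f x = 0 := by
  have hz : iteratedFDeriv ℝ (dirs α).length f x = 0 :=
    image_eq_zero_of_notMem_tsupport fun h => hx (tsupport_iteratedFDeriv_subset _ h)
  simp [pderiv, hz]

theorem pderiv_sub (α : Fin d → ℕ) {f g : Eu d → ℂ} {x : Eu d}
    (hf : ContDiffAt ℝ ∞ f x) (hg : ContDiffAt ℝ ∞ g x) :
    pderiv α (f - g) x = pderiv α f x - pderiv α g x := by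
  unfold pderiv
  rw [iteratedFDeriv_sub_apply (hf.of_le (by exact_mod_cast le_top))
    (hg.of_le (by exact_mod_cast le_top))]
  rfl

/-- A series of smooth functions all of whose partial derivatives are dominated by summable
sequences is smooth, and can be differentiated term by term. -/
theorem contDiff_tsum_of_pderiv {ι : Type*} {f : ι → Eu d → ℂ} (hf : ∀ n, ContDiff ℝ ∞ (f n))
    {M : (Fin d → ℕ) → ι → ℝ} (hM : ∀ α, Summable (M α))
    (hfM : ∀ α n x, ‖pderiv α (f n) x‖ ≤ M α n) :
    ContDiff ℝ ∞ (fun x => ∑' n, f n x) ∧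
      ∀ α x, HasSum (fun n => pderiv α (f n) x) (pderiv α (fun y => ∑' n, f n y) x) := by
  have hv : ∀ k : ℕ, (k : ℕ∞) ≤ (⊤ : ℕ∞) → Summable fun n => ∑ r : Fin k → Fin d,
      M (fun j => (List.ofFn r).count j) n := fun k _ => summable_sum fun r _ => hM _
  have hb : ∀ (k : ℕ) (n : ι) (x : Eu d), (k : ℕ∞) ≤ (⊤ : ℕ∞) → ‖iteratedFDeriv ℝ k (f n) x‖ ≤
      ∑ r : Fin k → Fin d, M (fun j => (List.ofFn r).count j) n := fun k n x _ =>
    (norm_iteratedFDeriv_le (hf n) k x).trans (Finset.sum_le_sum fun r _ => hfM _ _ _)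
  refine ⟨contDiff_tsum hf hv hb, fun α x => ?_⟩
  have h1 : HasSum (fun n => iteratedFDeriv ℝ (dirs α).length (f n) x)
      (iteratedFDeriv ℝ (dirs α).length (fun y => ∑' n, f n y) x) := by
    rw [iteratedFDeriv_tsum_apply hf hv hb le_top]
    exact ((hv (dirs α).length le_top).of_norm_bounded fun n => hb _ n x le_top).hasSum
  exact ContinuousMultilinearMap.hasSum_eval h1 _

/-! ### A Sobolev inequality for compactly supported functions -/

theorem hasDerivAt_comp_update {g : Eu d → ℂ} (hg : ContDiff ℝ ∞ g) (i : Fin d) (x : Fin d → ℝ)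
    (t : ℝ) :
    HasDerivAt (fun t => g (WithLp.toLp 2 (Function.update x i t)))
      (fderiv ℝ g (WithLp.toLp 2 (Function.update x i t)) (basisVec i)) t := by
  have h1 : HasDerivAt (fun t : ℝ => (WithLp.toLp 2 (Function.update x i t) : Eu d))
      (basisVec i) t :=
    ((PiLp.continuousLinearEquiv 2 ℝ fun _ : Fin d => ℝ).symm.toContinuousLinearMap.hasFDerivAt
      (x := Function.update x i t)).comp_hasDerivAt t (hasDerivAt_update x i t)
  exact ((hg.differentiable (by simp)) _).hasFDerivAt.comp_hasDerivAt t h1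

theorem contDiff_comp_update {g : Eu d → ℂ} (hg : ContDiff ℝ ∞ g) (i : Fin d) (x : Fin d → ℝ) :
    ContDiff ℝ 1 fun t => g (WithLp.toLp 2 (Function.update x i t)) := by
  have h2 : ContDiff ℝ 1 fun t : ℝ => (WithLp.toLp 2 (Function.update x i t) : Eu d) :=
    (PiLp.continuousLinearEquiv 2 ℝ fun _ : Fin d => ℝ).symm.contDiff.comp (contDiff_update 1 x i)
  exact (hg.of_le (by exact_mod_cast le_top)).comp h2

theorem hasCompactSupport_comp_update {g : Eu d → ℂ} (hg : HasCompactSupport g) (i : Fin d)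
    (x : Fin d → ℝ) :
    HasCompactSupport fun t => g (WithLp.toLp 2 (Function.update x i t)) :=
  hg.comp_isClosedEmbedding
    ((PiLp.homeomorph 2 fun _ : Fin d => ℝ).symm.isClosedEmbedding.comp
      (isClosedEmbedding_update x i))

theorem hasCompactSupport_pderiv {f : Eu d → ℂ} (hf : HasCompactSupport f) (α : Fin d → ℕ) :
    HasCompactSupport (pderiv α f) :=
  hf.of_isClosed_subset (isClosed_tsupport _) <| closure_minimal
    (fun _ hx => by_contra fun h => hx (pderiv_eq_zero_of_notMem_tsupport h α))
    (isClosed_tsupport _)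

/-- A compactly supported function of one variable is bounded by the integral of its derivative's
absolute value. Applying this along the coordinates of `S` one at a time costs one derivative and
one integration each; the induction runs over all `α` and `x` because both change at each stage. -/
theorem enorm_pderiv_le_lmarginal {f : Eu d → ℂ} (hf : ContDiff ℝ ∞ f) (hc : HasCompactSupport f)
    (S : Finset (Fin d)) (α : Fin d → ℕ) (x : Fin d → ℝ) :
    ‖pderiv α f (WithLp.toLp 2 x)‖ₑ ≤
      (∫⋯∫⁻_S, (fun y => ‖pderiv (α + ∑ i ∈ S, Pi.single i 1) f (WithLp.toLp 2 y)‖ₑ)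
        ∂(fun _ => volume)) x := by
  induction S using Finset.induction_on generalizing α x with
  | empty => simp
  | insert i S hi ih =>
    have hm : Measurable fun y : Fin d → ℝ =>
        ‖pderiv (α + ∑ i ∈ insert i S, Pi.single i 1) f (WithLp.toLp 2 y)‖ₑ :=
      ((contDiff_pderiv hf _).continuous.comp
        (PiLp.continuous_toLp 2 fun _ : Fin d => ℝ)).enorm.measurable
    rw [lmarginal_insert _ hm hi]
    have h1 := HasCompactSupport.enorm_le_lintegral_Ici_deriv
      (contDiff_comp_update (contDiff_pderiv hf α) i x)
      (hasCompactSupport_comp_update (hasCompactSupport_pderiv hc α) i x) (x i)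
    rw [Function.update_eq_self] at h1
    refine h1.trans ((setLIntegral_le_lintegral _ _).trans (lintegral_mono fun t => ?_))
    rw [(hasDerivAt_comp_update (contDiff_pderiv hf α) i x t).deriv, fderiv_pderiv hf,
      Finset.sum_insert hi, ← add_assoc]
    exact ih _ _

/-- The sup norm of a partial derivative of a compactly supported smooth function is bounded by
the `L¹` norm of a higher derivative. -/
theorem enorm_pderiv_le_lintegral {f : Eu d → ℂ} (hf : ContDiff ℝ ∞ f) (hc : HasCompactSupport f)
    (α : Fin d → ℕ) (x : Eu d) : ‖pderiv α f x‖ₑ ≤ ∫⁻ y, ‖pderiv (α + 1) f y‖ₑ := by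
  have h := enorm_pderiv_le_lmarginal hf hc Finset.univ α x.ofLp
  have h1 : ∑ i : Fin d, Pi.single i (1 : ℕ) = (1 : Fin d → ℕ) :=
    Finset.univ_sum_single (1 : Fin d → ℕ)
  rw [h1, lmarginal_univ] at h
  refine h.trans (le_of_eq ?_)
  exact (PiLp.volume_preserving_toLp (Fin d)).lintegral_comp
    (f := fun y => ‖pderiv (α + 1) f y‖ₑ) (contDiff_pderiv hf _).continuous.enorm.measurable

/-! ### Bounds for test functions and smoothness of the extension by zero. -/

theorem zeroExt_apply {U : Opens (Eu d)} (φ : U → ℂ) (x : U) : zeroExt U φ x = φ x := by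
  simp [zeroExt]

theorem zeroExt_of_notMem {U : Opens (Eu d)} (φ : U → ℂ) {x : Eu d} (hx : x ∉ U) :
    zeroExt U φ x = 0 := by
  simp [zeroExt, hx]

/-- The extension by zero as a linear map. -/
def zeroExtₗ (U : Opens (Eu d)) : (U → ℂ) →ₗ[ℂ] (Eu d → ℂ) where
  toFun := zeroExt U
  map_add' := zeroExt_add U
  map_smul' := zeroExt_smul U

theorem zeroExt_sub (U : Opens (Eu d)) (φ ψ : U → ℂ) :
    zeroExt U (φ - ψ) = zeroExt U φ - zeroExt U ψ := (zeroExtₗ U).map_sub φ ψ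

theorem exists_of_mem_testSubmodule {s : ℝ} {U : Opens (Eu d)} {φ : U → ℂ}
    (hφ : φ ∈ testSubmodule s U) : ContDiff ℝ ∞ (zeroExt U φ) ∧ HasCompactSupport (zeroExt U φ) ∧
      tsupport (zeroExt U φ) ⊆ U := by
  obtain ⟨K, hK, hKU, h⟩ := hφ
  obtain ⟨h1, h2, -⟩ := (Submodule.mem_iInf _).1 h ⟨1, Set.mem_Ioi.2 one_pos⟩
  exact ⟨h1, hK.of_isClosed_subset (isClosed_tsupport _) h2, h2.trans hKU⟩

theorem derivENorm_le_lpENorm {s : ℝ} {p : ENNReal} (hp : 1 ≤ p) {h : ℝ} (hh : 0 < h)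
    {U : Opens (Eu d)} (φ : U → ℂ) (α : Fin d → ℕ) :
    derivENorm p U φ α ≤ ENNReal.ofReal (weight s h α)⁻¹ * lpENorm s p h U φ := by
  have hw := weight_pos s hh α
  have key : ENNReal.ofReal (weight s h α) * derivENorm p U φ α ≤ lpENorm s p h U φ := by
    unfold lpENorm
    split_ifs with hpt
    · exact le_iSup (fun α => ENNReal.ofReal (weight s h α) * derivENorm p U φ α) α
    · have hp1 : 1 ≤ p.toReal := by
        rw [← ENNReal.toReal_one]; exact ENNReal.toReal_mono hpt hp
      rw [one_div, ENNReal.le_rpow_inv_iff (by linarith)]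
      exact ENNReal.le_tsum (f := fun α => (ENNReal.ofReal (weight s h α) *
        derivENorm p U φ α) ^ p.toReal) α
  calc derivENorm p U φ α
      = ENNReal.ofReal (weight s h α)⁻¹ * (ENNReal.ofReal (weight s h α) * derivENorm p U φ α) := by
        rw [← mul_assoc, ← ENNReal.ofReal_mul (by positivity), inv_mul_cancel₀ hw.ne']; simp
    _ ≤ _ := by gcongr

/-- The support condition reduces the Sobolev integral to `U`, where Hölder against the constant `1`
applies. For `p = ⊤` one has `p.toReal = 0` and `1 / 0 = 0`, so the exponent of the volume is `1`,
as it should be. -/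
theorem enorm_pderiv_le_derivENorm {U : Opens (Eu d)} {p : ENNReal} (hp : 1 ≤ p) {φ : U → ℂ}
    (hf : ContDiff ℝ ∞ (zeroExt U φ)) (hc : HasCompactSupport (zeroExt U φ))
    (ht : tsupport (zeroExt U φ) ⊆ U) (α : Fin d → ℕ) (x : Eu d) :
    ‖pderiv α (zeroExt U φ) x‖ₑ ≤
      derivENorm p U φ (α + 1) * volume (U : Set (Eu d)) ^ (1 - 1 / p.toReal) := by
  refine (enorm_pderiv_le_lintegral hf hc α x).trans ?_
  rw [← setLIntegral_eq_of_support_subset (s := (U : Set (Eu d))), ← eLpNorm_one_eq_lintegral_enorm]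
  · simpa [derivENorm] using eLpNorm_le_eLpNorm_mul_rpow_measure_univ (μ := volume.restrict (U : Set (Eu d))) hp
      (contDiff_pderiv hf (α + 1)).continuous.aestronglyMeasurable
  · intro y hy
    by_contra hyU
    exact hy (by simp [pderiv_eq_zero_of_notMem_tsupport (fun h => hyU (ht h))])

theorem lpENorm_eq_ofReal_norm {s : ℝ} {p : ENNReal} [Fact (1 ≤ p)] {h : Set.Ioi (0 : ℝ)} {U : Opens (Eu d)}
    (φ : LpSpace s p h U) : lpENorm s p h.1 U φ.fn = ENNReal.ofReal ‖φ‖ :=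
  (ENNReal.ofReal_toReal φ.2.2.ne).symm

/-- Bounds for all derivatives of test functions by a single norm. -/
theorem exists_pderiv_bound (s : ℝ) (p : ENNReal) [hp : Fact (1 ≤ p)] (h : Set.Ioi (0 : ℝ))
    (U : Opens (Eu d)) (hU : Bornology.IsBounded (U : Set (Eu d))) :
    ∃ C : (Fin d → ℕ) → ℝ, ∀ φ : LpSpace s p h U, φ.fn ∈ testSubmodule s U → ∀ α x,
      ‖pderiv α (zeroExt U φ.fn) x‖ ≤ C α * ‖φ‖ := by
  have hV : volume (U : Set (Eu d)) ^ (1 - 1 / p.toReal) ≠ ⊤ := by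
    refine ENNReal.rpow_ne_top_of_nonneg ?_ hU.measure_lt_top.ne
    rcases eq_or_ne p ⊤ with rfl | hpt
    · simp
    · have hp1 : 1 ≤ p.toReal := by
        rw [← ENNReal.toReal_one]; exact ENNReal.toReal_mono hpt hp.out
      rw [sub_nonneg, div_le_one (by linarith)]
      exact hp1
  refine ⟨fun α => (ENNReal.ofReal (weight s h.1 (α + 1))⁻¹ *
    volume (U : Set (Eu d)) ^ (1 - 1 / p.toReal)).toReal, fun φ hφ α x => ?_⟩
  obtain ⟨h1, h2, h3⟩ := exists_of_mem_testSubmodule hφ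
  have hb := (enorm_pderiv_le_derivENorm hp.out h1 h2 h3 α x).trans
    (mul_le_mul_left (derivENorm_le_lpENorm (s := s) hp.out h.2 φ.fn (α + 1)) _)
  rw [lpENorm_eq_ofReal_norm, mul_right_comm] at hb
  have hb' := ENNReal.toReal_mono (by finiteness) hb
  rw [ENNReal.toReal_mul, ENNReal.toReal_ofReal (norm_nonneg _), toReal_enorm] at hb'
  exact hb'

theorem exists_seq_test {s : ℝ} {p : ENNReal} [Fact (1 ≤ p)] {h : Set.Ioi (0 : ℝ)}
    {U : Opens (Eu d)} {φ : LpSpace s p h U} (hφ : φ ∈ LpClosure s p h U) :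
    ∃ t : ℕ → LpSpace s p h U, (∀ n, (t n).fn ∈ testSubmodule s U) ∧
      ∀ n, ‖t n - φ‖ < (1 / 2) ^ n := by
  have : ∀ n : ℕ, ∃ t : LpSpace s p h U, t.fn ∈ testSubmodule s U ∧ ‖t - φ‖ < (1 / 2) ^ n :=
    fun n => by
      have hφ' : φ ∈ closure (((testSubmodule s U).comap (LpSpace.fnₗ s p h U) :
        Submodule ℂ (LpSpace s p h U)) : Set (LpSpace s p h U)) := hφ
      obtain ⟨t, ht, htd⟩ := Metric.mem_closure_iff.1 hφ' ((1 / 2) ^ n) (by positivity)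
      exact ⟨t, ht, by rwa [← dist_eq_norm, dist_comm]⟩
  choose t ht using this
  exact ⟨t, fun n => (ht n).1, fun n => (ht n).2⟩

/-- The extension by zero of a function in `D^{(s)}_{L^p,h}(U)` is smooth on `ℝ^d`. -/
theorem contDiff_zeroExt {s : ℝ} {p : ENNReal} [hp : Fact (1 ≤ p)] {h : Set.Ioi (0 : ℝ)}
    {U : Opens (Eu d)} (hU : Bornology.IsBounded (U : Set (Eu d)))
    {φ : LpSpace s p h U} (hφ : φ ∈ LpClosure s p h U) : ContDiff ℝ ∞ (zeroExt U φ.fn) := by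
  obtain ⟨t, ht, htφ⟩ := exists_seq_test hφ
  obtain ⟨C, hC⟩ := exists_pderiv_bound s p h U hU
  -- Telescoping: the differences have geometrically small norms, so `t 0 + ∑ g n` can be
  -- differentiated term by term on all of `ℝ^d`.
  set g : ℕ → LpSpace s p h U := fun n => t (n + 1) - t n with hg
  have hgt : ∀ n, (g n).fn ∈ testSubmodule s U := fun n => Submodule.sub_mem _ (ht _) (ht _)
  have hgn : ∀ n, ‖g n‖ ≤ 2 * (1 / 2) ^ n := fun n => by
    have h1 : g n = (t (n + 1) - φ) - (t n - φ) := by simp [hg]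
    rw [h1]
    refine (norm_sub_le _ _).trans ?_
    have h2 := htφ (n + 1)
    have h3 := htφ n
    rw [pow_succ] at h2
    have h4 : (0 : ℝ) < (1 / 2) ^ n := by positivity
    linarith
  have hgs : Summable fun n => ‖g n‖ :=
    (summable_geometric_two.mul_left 2).of_nonneg_of_le (fun _ => norm_nonneg _) hgn
  obtain ⟨hF, hFs⟩ := contDiff_tsum_of_pderiv (f := fun n => zeroExt U (g n).fn)
    (fun n => (exists_of_mem_testSubmodule (hgt n)).1) (M := fun α n => C α * ‖g n‖)
    (fun α => hgs.mul_left _) (fun α n x => hC (g n) (hgt n) α x)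
  set F : Eu d → ℂ := zeroExt U (t 0).fn + fun x => ∑' n, zeroExt U (g n).fn x with hFdef
  have hFc : ContDiff ℝ ∞ F := (exists_of_mem_testSubmodule (ht 0)).1.add hF
  have hlim : ∀ x, Filter.Tendsto (fun n => zeroExt U (t n).fn x) Filter.atTop (𝓝 (F x)) := by
    intro x
    have h1 := (hFs 0 x).tendsto_sum_nat
    simp only [pderiv_zero] at h1
    have h2 : ∀ n, zeroExt U (t n).fn x =
        zeroExt U (t 0).fn x + ∑ i ∈ Finset.range n, zeroExt U (g i).fn x := fun n => by
      have h3 : ∀ i, zeroExt U (g i).fn x = zeroExt U (t (i + 1)).fn x - zeroExt U (t i).fn x :=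
        fun i => congrFun (zeroExt_sub U (t (i + 1)).fn (t i).fn) x
      rw [Finset.sum_congr rfl fun i _ => h3 i,
        Finset.sum_range_sub (fun i => zeroExt U (t i).fn x)]
      ring
    exact (h1.const_add _).congr fun n => (h2 n).symm
  have hF0 : ∀ x ∉ U, F x = 0 := fun x hx =>
    tendsto_nhds_unique (hlim x) (by simp [zeroExt_of_notMem _ hx])
  -- The smooth limit `F` must be identified with `φ` on `U`. Convergence in `L^p` gives an almost
  -- everywhere convergent subsequence, and two continuous functions equal almost everywhere on an
  -- open set are equal there.
  have hme : TendstoInMeasure (volume.restrict (U : Set (Eu d))) (fun n => zeroExt U (t n).fn)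
      Filter.atTop (zeroExt U φ.fn) := by
    refine tendstoInMeasure_of_tendsto_eLpNorm (p := p) (zero_lt_one.trans_le hp.out).ne'
      (fun n => ?_) ?_ ?_
    · exact (exists_of_mem_testSubmodule (ht n)).1.continuous.aestronglyMeasurable
    · have := pderiv_aestronglyMeasurable φ.2.1 0
      rwa [pderiv_zero] at this
    · have hb : ∀ n, eLpNorm (zeroExt U (t n).fn - zeroExt U φ.fn) p
          (volume.restrict (U : Set (Eu d))) ≤
          ENNReal.ofReal (weight s h.1 (0 : Fin d → ℕ))⁻¹ * ENNReal.ofReal ((1 / 2) ^ n) :=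
        fun n => by
          have h1 := derivENorm_le_lpENorm (s := s) hp.out h.2 (t n - φ).fn 0
          rw [lpENorm_eq_ofReal_norm] at h1
          have h2 : derivENorm p U (t n - φ).fn 0 = eLpNorm (zeroExt U (t n).fn - zeroExt U φ.fn) p
              (volume.restrict (U : Set (Eu d))) := by
            rw [derivENorm, pderiv_zero, ← zeroExt_sub]; rfl
          rw [← h2]
          exact h1.trans (by gcongr; exact (htφ n).le)
      refine tendsto_of_tendsto_of_tendsto_of_le_of_le tendsto_const_nhds ?_
        (fun _ => zero_le) hb
      have h3 : Filter.Tendsto (fun n : ℕ => ENNReal.ofReal ((1 / 2 : ℝ) ^ n)) Filter.atTop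
          (𝓝 0) := by
        have := ENNReal.tendsto_ofReal
          (tendsto_pow_atTop_nhds_zero_of_lt_one (r := (1 / 2 : ℝ)) (by norm_num) (by norm_num))
        simpa using this
      simpa using ENNReal.Tendsto.const_mul h3 (Or.inr ENNReal.ofReal_ne_top)
  obtain ⟨ns, hns, hae⟩ := hme.exists_seq_tendsto_ae
  have hae' : F =ᵐ[volume.restrict (U : Set (Eu d))] zeroExt U φ.fn := by
    filter_upwards [hae] with x hx
    exact tendsto_nhds_unique ((hlim x).comp hns.tendsto_atTop) hx
  have hEq := Measure.eqOn_open_of_ae_eq hae' U.isOpen hFc.continuous.continuousOn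
    (ContDiffOn.continuousOn φ.2.1)
  have : zeroExt U φ.fn = F := by
    funext x
    by_cases hx : x ∈ U
    · exact (hEq hx).symm
    · rw [hF0 x hx, zeroExt_of_notMem _ hx]
  rw [this]
  exact hFc

theorem tsupport_zeroExt_subset {U : Opens (Eu d)} (φ : U → ℂ) :
    tsupport (zeroExt U φ) ⊆ closure (U : Set (Eu d)) :=
  closure_mono fun _ hx => by_contra fun h => hx (zeroExt_of_notMem φ h)

/-! ### Extension by zero is isometric for `p = ∞` -/

/-- The part of `U` where `‖g‖` exceeds its essential supremum is open and null, hence empty. The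
bound then passes to the closure of `U` by continuity. -/
theorem eLpNorm_top_restrict_eq_iSup {U : Opens (Eu d)} {g : Eu d → ℂ} (hg : Continuous g) :
    eLpNorm g ⊤ (volume.restrict (U : Set (Eu d))) = ⨆ x ∈ closure (U : Set (Eu d)), ‖g x‖ₑ := by
  rw [eLpNorm_exponent_top]
  refine le_antisymm ?_ (iSup₂_le fun x hx => ?_)
  · refine essSup_le_of_ae_le _ ?_
    filter_upwards [ae_restrict_mem U.isOpen.measurableSet] with x hx
    exact le_iSup₂ (f := fun x (_ : x ∈ closure (U : Set (Eu d))) => ‖g x‖ₑ) x (subset_closure hx)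
  · set M := eLpNormEssSup g (volume.restrict (U : Set (Eu d)))
    have h1 : ∀ᵐ y ∂(volume.restrict (U : Set (Eu d))), ‖g y‖ₑ ≤ M := ae_le_eLpNormEssSup
    have hopen : IsOpen ({y | M < ‖g y‖ₑ} ∩ (U : Set (Eu d))) :=
      (isOpen_lt continuous_const hg.enorm).inter U.isOpen
    have h2 : volume ({y | M < ‖g y‖ₑ} ∩ (U : Set (Eu d))) = 0 := by
      rw [ae_iff, Measure.restrict_apply₀'
        U.isOpen.measurableSet.nullMeasurableSet] at h1
      simpa using h1
    have h3 := (hopen.measure_eq_zero_iff volume).1 h2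
    have hcl : IsClosed {y | ‖g y‖ₑ ≤ M} := isClosed_le hg.enorm continuous_const
    refine closure_minimal (fun y hy => ?_) hcl hx
    by_contra hlt
    exact (Set.eq_empty_iff_forall_notMem.1 h3) y ⟨show M < ‖g y‖ₑ from lt_of_not_ge hlt, hy⟩

theorem lpENorm_top_eq_supENorm (s h : ℝ) {U : Opens (Eu d)} {φ : U → ℂ}
    (hφ : ContDiff ℝ ∞ (zeroExt U φ)) :
    lpENorm s ⊤ h U φ = supENorm s h (closure (U : Set (Eu d))) (zeroExt U φ) := by
  simp only [lpENorm, if_true, supENorm, derivENorm,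
    eLpNorm_top_restrict_eq_iSup (contDiff_pderiv hφ _).continuous, ENNReal.mul_iSup]

theorem Comp.weight_mul_norm_le {s : ℝ} {h : Set.Ioi (0 : ℝ)} {K : Set (Eu d)} (f : Comp s h K)
    (α : Fin d → ℕ) (x : Eu d) : weight s h.1 α * ‖pderiv α f.fn x‖ ≤ ‖f‖ := by
  by_cases hx : x ∈ K
  · have h1 := ENNReal.toReal_mono f.2.2.2.ne (supENorm_ge s h.1 hx f.fn α)
    rwa [ENNReal.toReal_mul, ENNReal.toReal_ofReal (weight_pos s h.2 α).le, toReal_enorm] at h1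
  · have h0 : pderiv α f.fn x = 0 :=
      pderiv_eq_zero_of_notMem_tsupport (fun h' => hx (f.2.2.1 h')) α
    simp [h0]

theorem weight_zero (s h : ℝ) : weight s h (0 : Fin d → ℕ) = 1 := by simp [weight]

theorem Comp.norm_apply_le {s : ℝ} {h : Set.Ioi (0 : ℝ)} {K : Set (Eu d)} (f : Comp s h K)
    (x : Eu d) : ‖f.fn x‖ ≤ ‖f‖ := by
  simpa [weight_zero, pderiv_zero] using f.weight_mul_norm_le 0 x

theorem Comp.norm_le {s : ℝ} {h : Set.Ioi (0 : ℝ)} {K : Set (Eu d)} (f : Comp s h K) {C : ℝ}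
    (hC : 0 ≤ C) (H : ∀ α x, weight s h.1 α * ‖pderiv α f.fn x‖ ≤ C) : ‖f‖ ≤ C := by
  refine ENNReal.toReal_le_of_le_ofReal hC (iSup_le fun α => iSup₂_le fun x _ => ?_)
  rw [← ofReal_norm, ← ENNReal.ofReal_mul (weight_pos s h.2 α).le]
  exact ENNReal.ofReal_le_ofReal (H α x)

section Extension

variable {s : ℝ} {h : Set.Ioi (0 : ℝ)} {U : Opens (Eu d)}

theorem norm_eq_of_fn_eq {f : Comp s h (closure (U : Set (Eu d)))} {φ : LpSpace s ⊤ h U}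
    (hf : f.fn = zeroExt U φ.fn) : ‖f‖ = ‖φ‖ := by
  have h1 : ContDiff ℝ ∞ (zeroExt U φ.fn) := by rw [← hf]; exact f.2.1
  change (supENorm s h.1 _ f.fn).toReal = (lpENorm s ⊤ h.1 U φ.fn).toReal
  rw [lpENorm_top_eq_supENorm s h.1 h1, hf]

theorem zeroExt_mem_compSubmodule (hU : Bornology.IsBounded (U : Set (Eu d)))
    {φ : LpSpace s ⊤ h U} (hφ : φ ∈ LpClosure s ⊤ h U) :
    zeroExt U φ.fn ∈ compSubmodule s h.1 (closure (U : Set (Eu d))) :=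
  ⟨contDiff_zeroExt hU hφ, tsupport_zeroExt_subset _, by
    rw [← lpENorm_top_eq_supENorm s h.1 (contDiff_zeroExt hU hφ)]; exact φ.2.2⟩

variable (s h) in
/-- The extension by zero as an isometry from `D^{(s)}_{L^∞,h}(U)` to `D^{s,h}_{closure U}`. -/
def extComp (hU : Bornology.IsBounded (U : Set (Eu d))) :
    LpClosure s ⊤ h U →ₗᵢ[ℂ] Comp s h (closure (U : Set (Eu d))) where
  toFun φ := (⟨zeroExt U φ.1.fn, zeroExt_mem_compSubmodule hU φ.2⟩ : compSubmodule s h.1 _)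
  map_add' φ ψ := Subtype.ext (zeroExt_add U φ.1.fn ψ.1.fn)
  map_smul' c φ := Subtype.ext (zeroExt_smul U c φ.1.fn)
  norm_map' φ := norm_eq_of_fn_eq (φ := φ.1) rfl

theorem extComp_fn (hU : Bornology.IsBounded (U : Set (Eu d))) (φ : LpClosure s ⊤ h U) :
    (extComp s h hU φ).fn = zeroExt U φ.1.fn := rfl

theorem zeroExt_restrict {f : Eu d → ℂ} (hf : ∀ x ∉ U, f x = 0) :
    zeroExt U (fun x => f x) = f := by
  funext x
  by_cases hx : x ∈ U
  · exact zeroExt_apply (fun x : U => f x) ⟨x, hx⟩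
  · rw [zeroExt_of_notMem _ hx, hf x hx]

theorem Comp.ext {K : Set (Eu d)} {f g : Comp s h K} (H : f.fn = g.fn) : f = g := Subtype.ext H

/-- Convergence in `D^{s,h}_K` dominates uniform convergence, so a limit `f` of extensions vanishes
off `U` and is the extension of its own restriction. By the isometry this restriction is a limit of
elements of the closed subspace `LpClosure`. -/
theorem isClosed_range_extComp (hU : Bornology.IsBounded (U : Set (Eu d))) :
    IsClosed (Set.range (extComp s h hU)) := by
  refine isClosed_of_closure_subset fun f hf => ?_
  have hf' : ∀ ε > 0, ∃ ψ : LpClosure s ⊤ h U, ‖f - extComp s h hU ψ‖ < ε := fun ε hε => by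
    obtain ⟨_, ⟨ψ, rfl⟩, hψ⟩ := Metric.mem_closure_iff.1 hf ε hε
    exact ⟨ψ, by rwa [← dist_eq_norm]⟩
  have h0 : ∀ x ∉ U, f.fn x = 0 := fun x hx => by
    refine norm_le_zero_iff.1 (le_of_forall_pos_le_add fun ε hε => ?_)
    obtain ⟨ψ, hψ⟩ := hf' ε hε
    have h1 := (f - extComp s h hU ψ).norm_apply_le x
    have h2 : (f - extComp s h hU ψ).fn x = f.fn x - zeroExt U ψ.1.fn x := rfl
    rw [h2, zeroExt_of_notMem _ hx, sub_zero] at h1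
    linarith
  have h3 := zeroExt_restrict h0
  have hsm : ContDiff ℝ ∞ (zeroExt U (fun x => f.fn x)) := by rw [h3]; exact f.2.1
  let φ : LpSpace s ⊤ h U := (⟨fun x => f.fn x, hsm.contDiffOn, by
    rw [lpENorm_top_eq_supENorm s h.1 hsm, h3]; exact f.2.2.2⟩ : lpSubmodule s ⊤ h.1 U)
  have hφ : φ ∈ LpClosure s ⊤ h U := by
    have hcl : IsClosed (LpClosure s ⊤ h U : Set (LpSpace s ⊤ h U)) :=
      Submodule.isClosed_topologicalClosure _
    rw [← SetLike.mem_coe, ← hcl.closure_eq, Metric.mem_closure_iff]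
    intro ε hε
    obtain ⟨ψ, hψ⟩ := hf' ε hε
    refine ⟨ψ.1, ψ.2, ?_⟩
    rw [dist_eq_norm, ← norm_eq_of_fn_eq (f := f - extComp s h hU ψ)]
    · exact hψ
    · have h4 : zeroExt U (φ - ψ.1).fn = zeroExt U φ.fn - zeroExt U ψ.1.fn := zeroExt_sub U _ _
      rw [h4]
      exact congrArg (· - zeroExt U ψ.1.fn) h3.symm
  exact ⟨⟨φ, hφ⟩, Comp.ext h3⟩

end Extension

/-! ### Completeness -/

/-- Absolutely summable series converge: the norm controls each derivative uniformly, so the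
pointwise sum is smooth and is differentiated term by term. -/
theorem completeSpace_comp {s : ℝ} {h : Set.Ioi (0 : ℝ)} {K : Set (Eu d)} (hK : IsClosed K) :
    CompleteSpace (Comp s h K) := by
  refine NormedAddCommGroup.completeSpace_of_summable_imp_tendsto fun u hu => ?_
  have hb : ∀ α n x, ‖pderiv α (u n).fn x‖ ≤ (weight s h.1 α)⁻¹ * ‖u n‖ := fun α n x => by
    rw [← div_eq_inv_mul, le_div_iff₀' (weight_pos s h.2 α)]
    exact (u n).weight_mul_norm_le α x
  obtain ⟨hF, hFs⟩ := contDiff_tsum_of_pderiv (f := fun n => (u n).fn) (fun n => (u n).2.1)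
    (M := fun α n => (weight s h.1 α)⁻¹ * ‖u n‖) (fun α => hu.mul_left _) hb
  set F : Eu d → ℂ := fun x => ∑' n, (u n).fn x
  have hsum : ∀ N, (∑ i ∈ Finset.range N, u i).fn = ∑ i ∈ Finset.range N, (u i).fn := fun N =>
    map_sum (compSubmodule s h.1 K).subtype u (Finset.range N)
  -- Uniformity in `α` and `x` is the point: `N = 0` yields finiteness of the norm of `F`, and `N →
  -- ∞` yields convergence in norm.
  have htail : ∀ N α x, weight s h.1 α * ‖pderiv α (F - (∑ i ∈ Finset.range N, u i).fn) x‖ ≤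
      ∑' n, ‖u (n + N)‖ := fun N α x => by
    have hsN : ContDiff ℝ ∞ (∑ i ∈ Finset.range N, u i).fn := (∑ i ∈ Finset.range N, u i).2.1
    have hp : pderiv α (∑ i ∈ Finset.range N, u i).fn x =
        ∑ i ∈ Finset.range N, pderiv α (u i).fn x := by
      clear_value F
      clear hsN
      induction N with
      | zero =>
        have : pderiv α (0 : Eu d → ℂ) x = 0 := pderiv_eq_zero_of_notMem_tsupport (by simp) α
        rw [Finset.sum_range_zero, Finset.sum_range_zero]
        exact this
      | succ N ih =>
        rw [Finset.sum_range_succ, Finset.sum_range_succ, ← ih]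
        exact pderiv_add α (f := (∑ i ∈ Finset.range N, u i).fn) (g := (u N).fn)
          (∑ i ∈ Finset.range N, u i).2.1.contDiffAt (u N).2.1.contDiffAt
    rw [pderiv_sub α hF.contDiffAt hsN.contDiffAt, hp]
    have h1 := (hasSum_nat_add_iff' N).2 (hFs α x)
    have hs' : Summable fun n => ‖u (n + N)‖ := (summable_nat_add_iff N).2 hu
    rw [← h1.tsum_eq, ← le_div_iff₀' (weight_pos s h.2 α), div_eq_inv_mul, ← tsum_mul_left]
    exact tsum_of_norm_bounded (hs'.mul_left _).hasSum fun n => hb α _ x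
  have h0 : Filter.Tendsto (fun N => ∑' n, ‖u (n + N)‖) Filter.atTop (𝓝 0) :=
    tendsto_sum_nat_add fun n => ‖u n‖
  have hsupp : tsupport F ⊆ K := by
    refine closure_minimal (fun x hx => by_contra fun hxK => hx ?_) hK
    have : ∀ n, (u n).fn x = 0 := fun n =>
      image_eq_zero_of_notMem_tsupport fun hx' => hxK ((u n).2.2.1 hx')
    simp [F, this]
  have hfin : supENorm s h.1 K F < ⊤ := by
    refine lt_of_le_of_lt (b := ENNReal.ofReal (∑' n, ‖u n‖))
      (iSup_le fun α => iSup₂_le fun x _ => ?_) ENNReal.ofReal_lt_top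
    rw [← ofReal_norm, ← ENNReal.ofReal_mul (weight_pos s h.2 α).le]
    refine ENNReal.ofReal_le_ofReal ?_
    have h1 := htail 0 α x
    have h2 : F - (∑ i ∈ Finset.range 0, u i).fn = F := by
      rw [Finset.sum_range_zero]; exact sub_zero F
    rwa [h2] at h1
  let G : Comp s h K := (⟨F, hF, hsupp, hfin⟩ : compSubmodule s h.1 K)
  refine ⟨G, tendsto_iff_norm_sub_tendsto_zero.2 ?_⟩
  refine squeeze_zero (fun _ => norm_nonneg _) (fun N => ?_) h0
  rw [norm_sub_rev]
  exact Comp.norm_le _ (tsum_nonneg fun _ => norm_nonneg _) (htail N)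

theorem completeSpace_lpClosure {s : ℝ} {h : Set.Ioi (0 : ℝ)} {U : Opens (Eu d)}
    (hU : Bornology.IsBounded (U : Set (Eu d))) : CompleteSpace (LpClosure s ⊤ h U) := by
  have := completeSpace_comp (s := s) (h := h) (isClosed_closure (s := (U : Set (Eu d))))
  have h1 := (extComp s h hU).isometry
  exact h1.isUniformInducing.completeSpace (isClosed_range_extComp hU).isComplete

end Gevrey

namespace Gevrey

variable {d : ℕ} {s : ℝ} {U : Opens (Eu d)}

/-! ### Linking maps and projections -/

theorem weight_mono (s : ℝ) {h h₁ : ℝ} (hh : 0 < h) (hle : h ≤ h₁) (α : Fin d → ℕ) :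
    weight s h α ≤ weight s h₁ α := by
  unfold weight
  gcongr

theorem lpENorm_top_mono (s : ℝ) {h h₁ : ℝ} (hh : 0 < h) (hle : h ≤ h₁) (φ : U → ℂ) :
    lpENorm s ⊤ h U φ ≤ lpENorm s ⊤ h₁ U φ := by
  simp only [lpENorm, if_true]
  gcongr with α
  exact weight_mono s hh hle α

/-- An element of `D^s_{L^p,h}(U)` given by a function. -/
def LpSpace.mk {p : ENNReal} [Fact (1 ≤ p)] {h : Set.Ioi (0 : ℝ)} (f : U → ℂ)
    (hf : f ∈ lpSubmodule s p h.1 U) : LpSpace s p h U := ⟨f, hf⟩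

theorem LpSpace.mk_fn {p : ENNReal} [Fact (1 ≤ p)] {h : Set.Ioi (0 : ℝ)} (f : U → ℂ)
    (hf : f ∈ lpSubmodule s p h.1 U) : (LpSpace.mk f hf).fn = f := rfl

theorem LpSpace.ext {p : ENNReal} [Fact (1 ≤ p)] {h : Set.Ioi (0 : ℝ)}
    {φ ψ : LpSpace s p h U} (H : φ.fn = ψ.fn) : φ = ψ :=
  Subtype.ext H

theorem LpSpace.fn_mem_of_le {h h₁ : Set.Ioi (0 : ℝ)} (hle : h ≤ h₁) (φ : LpSpace s ⊤ h₁ U) :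
    φ.fn ∈ lpSubmodule s ⊤ h.1 U :=
  ⟨φ.2.1, (lpENorm_top_mono s h.2 hle φ.fn).trans_lt φ.2.2⟩

/-- The inclusion of `D^s_{L^∞,h₁}(U)` into `D^s_{L^∞,h}(U)` for `h ≤ h₁`, as a linear map. -/
def LpSpace.linkₗ (s : ℝ) (U : Opens (Eu d)) {h h₁ : Set.Ioi (0 : ℝ)} (hle : h ≤ h₁) :
    LpSpace s ⊤ h₁ U →ₗ[ℂ] LpSpace s ⊤ h U where
  toFun φ := LpSpace.mk φ.fn (φ.fn_mem_of_le hle)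
  map_add' φ ψ := LpSpace.ext ((LpSpace.fnₗ s ⊤ h₁ U).map_add φ ψ)
  map_smul' c φ := LpSpace.ext ((LpSpace.fnₗ s ⊤ h₁ U).map_smul c φ)

theorem LpSpace.linkₗ_fn {h h₁ : Set.Ioi (0 : ℝ)} (hle : h ≤ h₁) (φ : LpSpace s ⊤ h₁ U) :
    (LpSpace.linkₗ s U hle φ).fn = φ.fn :=
  LpSpace.mk_fn φ.fn (φ.fn_mem_of_le hle)

theorem LpSpace.norm_linkₗ_le {h h₁ : Set.Ioi (0 : ℝ)} (hle : h ≤ h₁) (φ : LpSpace s ⊤ h₁ U) :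
    ‖LpSpace.linkₗ s U hle φ‖ ≤ ‖φ‖ := by
  change (lpENorm s ⊤ h.1 U (LpSpace.linkₗ s U hle φ).fn).toReal ≤
    (lpENorm s ⊤ h₁.1 U φ.fn).toReal
  rw [LpSpace.linkₗ_fn]
  exact ENNReal.toReal_mono φ.2.2.ne (lpENorm_top_mono s h.2 hle φ.fn)

/-- The inclusion of `D^s_{L^∞,h₁}(U)` into `D^s_{L^∞,h}(U)` for `h ≤ h₁`. -/
def LpSpace.link (s : ℝ) (U : Opens (Eu d)) {h h₁ : Set.Ioi (0 : ℝ)} (hle : h ≤ h₁) :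
    LpSpace s ⊤ h₁ U →L[ℂ] LpSpace s ⊤ h U where
  toLinearMap := LpSpace.linkₗ s U hle
  cont := AddMonoidHomClass.continuous_of_bound (LpSpace.linkₗ s U hle) 1 fun φ => by
    rw [one_mul]; exact LpSpace.norm_linkₗ_le hle φ

theorem LpSpace.link_fn {h h₁ : Set.Ioi (0 : ℝ)} (hle : h ≤ h₁) (φ : LpSpace s ⊤ h₁ U) :
    (LpSpace.link s U hle φ).fn = φ.fn := LpSpace.linkₗ_fn hle φ

theorem mem_comap_test_iff {p : ENNReal} [Fact (1 ≤ p)] {h : Set.Ioi (0 : ℝ)}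
    {φ : LpSpace s p h U} :
    φ ∈ (testSubmodule s U).comap (LpSpace.fnₗ s p h U) ↔ φ.fn ∈ testSubmodule s U := Iff.rfl

theorem link_mem_comap_test {h h₁ : Set.Ioi (0 : ℝ)} (hle : h ≤ h₁) {φ : LpSpace s ⊤ h₁ U}
    (hφ : φ ∈ (testSubmodule s U).comap (LpSpace.fnₗ s ⊤ h₁ U)) :
    LpSpace.link s U hle φ ∈ (testSubmodule s U).comap (LpSpace.fnₗ s ⊤ h U) := by
  rw [mem_comap_test_iff] at hφ ⊢
  rwa [LpSpace.link_fn]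

theorem link_mem_lpClosure {h h₁ : Set.Ioi (0 : ℝ)} (hle : h ≤ h₁) {φ : LpSpace s ⊤ h₁ U}
    (hφ : φ ∈ LpClosure s ⊤ h₁ U) : LpSpace.link s U hle φ ∈ LpClosure s ⊤ h U :=
  map_mem_closure (LpSpace.link s U hle).continuous hφ fun _ hψ => link_mem_comap_test hle hψ

/-- The linking inclusion `D^{(s)}_{L^∞,h₁}(U) → D^{(s)}_{L^∞,h}(U)` for `h ≤ h₁`. -/
def linkClosure (s : ℝ) (U : Opens (Eu d)) {h h₁ : Set.Ioi (0 : ℝ)} (hle : h ≤ h₁) :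
    LpClosure s ⊤ h₁ U →L[ℂ] LpClosure s ⊤ h U where
  toLinearMap := ((LpSpace.linkₗ s U hle).comp (LpClosure s ⊤ h₁ U).subtype).codRestrict
    (LpClosure s ⊤ h U) fun φ => link_mem_lpClosure hle φ.2
  cont := ((LpSpace.link s U hle).continuous.comp continuous_subtype_val).subtype_mk _

theorem linkClosure_fn {h h₁ : Set.Ioi (0 : ℝ)} (hle : h ≤ h₁) (φ : LpClosure s ⊤ h₁ U) :
    (linkClosure s U hle φ).1.fn = φ.1.fn := LpSpace.link_fn hle φ.1

theorem continuous_beurling_incl (h : Set.Ioi (0 : ℝ)) : Continuous (Beurling.incl s ⊤ U h) :=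
  continuous_iInf_dom continuous_induced_dom

theorem incl_mem_lpClosure (h : Set.Ioi (0 : ℝ)) {φ : Beurling s ⊤ U} (hφ : φ ∈ BDot s U) :
    Beurling.incl s ⊤ U h φ ∈ LpClosure s ⊤ h U :=
  map_mem_closure (continuous_beurling_incl h) hφ fun _ hψ => hψ

/-- The inclusion `Ḃ^{(s)}(U) → D^{(s)}_{L^∞,h}(U)`. -/
def BDot.proj (s : ℝ) (U : Opens (Eu d)) (h : Set.Ioi (0 : ℝ)) :
    BDot s U →L[ℂ] LpClosure s ⊤ h U where
  toLinearMap := ((Beurling.incl s ⊤ U h).comp (BDot s U).subtype).codRestrict (LpClosure s ⊤ h U)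
    fun φ => incl_mem_lpClosure h φ.2
  cont := ((continuous_beurling_incl h).comp continuous_subtype_val).subtype_mk _

theorem BDot.proj_fn (h : Set.Ioi (0 : ℝ)) (φ : BDot s U) : (BDot.proj s U h φ).1.fn = φ.1.fn :=
  rfl

theorem LpClosure.ext {p : ENNReal} [Fact (1 ≤ p)] {h : Set.Ioi (0 : ℝ)}
    {φ ψ : LpClosure s p h U} (H : φ.1.fn = ψ.1.fn) : φ = ψ :=
  Subtype.ext (Subtype.ext H)

theorem BDot.ext {φ ψ : BDot s U} (H : φ.1.fn = ψ.1.fn) : φ = ψ :=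
  Subtype.ext (Subtype.ext H)

theorem linkClosure_proj {h h₁ : Set.Ioi (0 : ℝ)} (hle : h ≤ h₁) (φ : BDot s U) :
    linkClosure s U hle (BDot.proj s U h₁ φ) = BDot.proj s U h φ :=
  LpClosure.ext ((linkClosure_fn hle _).trans ((BDot.proj_fn h₁ φ).trans (BDot.proj_fn h φ).symm))

/-- The topology of `Ḃ^{(s)}(U)` is the initial topology of any cofinal family of projections. -/
theorem BDot.topology_eq_iInf {ι : Type*} (H : ι → Set.Ioi (0 : ℝ)) (hH : ∀ h, ∃ i, h ≤ H i) :
    (inferInstance : TopologicalSpace (BDot s U)) =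
      ⨅ i, TopologicalSpace.induced (BDot.proj s U (H i)) inferInstance := by
  have h1 : (inferInstance : TopologicalSpace (BDot s U)) =
      ⨅ h, TopologicalSpace.induced (BDot.proj s U h) inferInstance := by
    change TopologicalSpace.induced Subtype.val (⨅ h, _) = _
    rw [induced_iInf]
    refine iInf_congr fun h => ?_
    change _ = TopologicalSpace.induced _ (TopologicalSpace.induced Subtype.val _)
    rw [induced_compose, induced_compose]
    rfl
  rw [h1]
  refine le_antisymm (le_iInf fun i => iInf_le _ _) (le_iInf fun h => ?_)
  obtain ⟨i, hi⟩ := hH h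
  refine (iInf_le _ i).trans ?_
  -- Cofinality suffices because the projection to `h` factors continuously through the one to `H i
  -- ≥ h`.
  have h2 : (BDot.proj s U h : BDot s U → LpClosure s ⊤ h U) =
      linkClosure s U hi ∘ BDot.proj s U (H i) := funext fun φ => (linkClosure_proj hi φ).symm
  rw [h2, ← induced_compose]
  exact induced_mono (linkClosure s U hi).continuous.le_induced

/-- The linking maps make the pulled-back neighbourhood filters directed in `h`, so one norm is
enough instead of finitely many. -/
theorem exists_ball_subset_of_mem_nhds {φ : Beurling s ⊤ U} {O : Set (Beurling s ⊤ U)}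
    (hO : O ∈ 𝓝 φ) : ∃ (h : Set.Ioi (0 : ℝ)) (ε : ℝ), 0 < ε ∧
      ∀ ψ, ‖Beurling.incl s ⊤ U h ψ - Beurling.incl s ⊤ U h φ‖ < ε → ψ ∈ O := by
  have hdir : Directed (· ≥ ·) fun h : Set.Ioi (0 : ℝ) =>
      Filter.comap (Beurling.incl s ⊤ U h) (𝓝 (Beurling.incl s ⊤ U h φ)) := by
    refine Antitone.directed_ge fun h h₁ hle => ?_
    have h2 : (Beurling.incl s ⊤ U h : Beurling s ⊤ U → _) =
      LpSpace.link s U hle ∘ Beurling.incl s ⊤ U h₁ := rfl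
    simp only [h2, ← Filter.comap_comap]
    exact Filter.comap_mono ((LpSpace.link s U hle).continuous.tendsto _).le_comap
  have h1 : 𝓝 φ = ⨅ h : Set.Ioi (0 : ℝ),
      Filter.comap (Beurling.incl s ⊤ U h) (𝓝 (Beurling.incl s ⊤ U h φ)) := by
    refine nhds_iInf.trans (iInf_congr fun h => ?_)
    exact nhds_induced _ _
  have : Nonempty (Set.Ioi (0 : ℝ)) := ⟨⟨1, Set.mem_Ioi.2 one_pos⟩⟩
  rw [h1, Filter.mem_iInf_of_directed hdir] at hO
  obtain ⟨h, hh⟩ := hO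
  obtain ⟨ε, hε, hsub⟩ := (Metric.nhds_basis_ball.comap _).mem_iff.1 hh
  exact ⟨h, ε, hε, fun ψ hψ => hsub (by rwa [Set.mem_preimage, mem_ball_iff_norm])⟩

theorem mem_beurlingSubmodule_of_test {φ : U → ℂ} (hφ : φ ∈ testSubmodule s U) :
    φ ∈ beurlingSubmodule s ⊤ U := by
  have hsm := (exists_of_mem_testSubmodule hφ).1
  obtain ⟨K, -, hKU, hK⟩ := hφ
  have h1 := zeroExt_mem_mono (hKU.trans subset_closure) hK
  refine (Submodule.mem_iInf _).2 fun h => ⟨hsm.contDiffOn, ?_⟩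
  rw [lpENorm_top_eq_supENorm s h.1 hsm]
  exact ((Submodule.mem_iInf _).1 h1 h).2.2

/-- A given neighbourhood only tests one norm, and a test function close to `φ` in that norm belongs
to all the spaces at once. The approximants for different `h` need not be related. -/
theorem mem_BDot_of_forall {φ : Beurling s ⊤ U}
    (H : ∀ h, Beurling.incl s ⊤ U h φ ∈ LpClosure s ⊤ h U) : φ ∈ BDot s U := by
  refine mem_closure_iff_nhds.2 fun O hO => ?_
  obtain ⟨h, ε, hε, hsub⟩ := exists_ball_subset_of_mem_nhds hO
  obtain ⟨t, ht, htd⟩ := Metric.mem_closure_iff.1 (H h) ε hε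
  refine ⟨(⟨t.fn, mem_beurlingSubmodule_of_test ht⟩ : beurlingSubmodule s ⊤ U), hsub _ ?_, ht⟩
  rw [dist_comm, dist_eq_norm] at htd
  exact htd

/-- The compatible families in the spaces `D^{(s)}_{L^∞,h}(U)` are the elements of
`Ḃ^{(s)}(U)`. -/
theorem exists_of_forall_mem {f : U → ℂ}
    (H : ∀ h : Set.Ioi (0 : ℝ), ∃ φ : LpClosure s ⊤ h U, φ.1.fn = f) :
    ∃ φ : BDot s U, φ.1.fn = f := by
  have hf : f ∈ beurlingSubmodule s ⊤ U := (Submodule.mem_iInf _).2 fun h => by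
    obtain ⟨φ, rfl⟩ := H h
    exact φ.1.2
  refine ⟨⟨(⟨f, hf⟩ : beurlingSubmodule s ⊤ U), mem_BDot_of_forall fun h => ?_⟩, rfl⟩
  obtain ⟨φ, hφ⟩ := H h
  have : Beurling.incl s ⊤ U h (⟨f, hf⟩ : beurlingSubmodule s ⊤ U) = φ.1 := Subtype.ext hφ.symm
  rw [this]
  exact φ.2

/-- Stated for any cofinal monotone family `H`, in order to serve both for all `h > 0` and for the
sequence in the (FS) representation. -/
theorem isTVSProjectiveLimit_BDot {ι : Type*} [Preorder ι] [IsDirectedOrder ι] [Nonempty ι]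
    {H : ι → Set.Ioi (0 : ℝ)} (hmono : Monotone H) (hH : ∀ h, ∃ i, h ≤ H i) :
    IsTVSProjectiveLimit (fun i j (hij : i ≤ j) => linkClosure s U (hmono hij))
      (fun i => BDot.proj s U (H i)) where
  link_refl _ _ := LpClosure.ext (linkClosure_fn le_rfl _)
  link_trans i j k hij hjk x := LpClosure.ext <| by
    rw [linkClosure_fn, linkClosure_fn, linkClosure_fn]
  isEmbedding := by
    refine ⟨⟨?_⟩, fun φ ψ hφψ => ?_⟩
    · refine (BDot.topology_eq_iInf H hH).trans ?_
      rw [Pi.topologicalSpace, induced_iInf]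
      refine iInf_congr fun i => ?_
      rw [induced_compose]
      rfl
    · obtain ⟨i⟩ := (inferInstance : Nonempty ι)
      exact BDot.ext (congrArg (fun χ : LpClosure s ⊤ (H i) U => χ.1.fn) (congrFun hφψ i))
  range_eq := by
    ext y
    constructor
    · rintro ⟨φ, rfl⟩ i j hij
      exact linkClosure_proj (hmono hij) φ
    · intro hy
      obtain ⟨i₀⟩ := (inferInstance : Nonempty ι)
      have hy' : ∀ i j (hij : i ≤ j), (y j).1.fn = (y i).1.fn := fun i j hij =>
        (linkClosure_fn (hmono hij) (y j)).symm.trans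
          (congrArg (fun χ : LpClosure s ⊤ (H i) U => χ.1.fn) (hy i j hij))
      -- Linking maps do not change the underlying function, so by directedness a thread is a single
      -- function seen in every space.
      have hconst : ∀ i, (y i).1.fn = (y i₀).1.fn := fun i => by
        obtain ⟨k, hik, hk⟩ := exists_ge_ge i i₀
        rw [← hy' i k hik, hy' i₀ k hk]
      obtain ⟨φ, hφ⟩ := exists_of_forall_mem (s := s) (f := (y i₀).1.fn) fun h => by
        obtain ⟨i, hi⟩ := hH h
        exact ⟨linkClosure s U hi (y i), (linkClosure_fn hi _).trans (hconst i)⟩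
      exact ⟨φ, funext fun i => LpClosure.ext (hφ.trans (hconst i).symm)⟩

/-! ### Extension by zero on `Ḃ^{(s)}(U)` -/

/-- The extension by zero as a linear map from `Ḃ^{(s)}(U)` to `D^{(s)}_{closure U}`. -/
def BDot.extₗ (s : ℝ) (hU : Bornology.IsBounded (U : Set (Eu d))) :
    BDot s U →ₗ[ℂ] BeurlingComp s (closure (U : Set (Eu d))) where
  toFun φ := (⟨zeroExt U φ.1.fn, (Submodule.mem_iInf _).2 fun h =>
    zeroExt_mem_compSubmodule hU (BDot.proj s U h φ).2⟩ : beurlingCompSubmodule s _)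
  map_add' φ ψ := Subtype.ext (zeroExt_add U φ.1.fn ψ.1.fn)
  map_smul' c φ := Subtype.ext (zeroExt_smul U c φ.1.fn)

/-- Both topologies are initial for their projections to the levels `h`, and the isometry `extComp`
intertwines these projections at each level. -/
theorem isInducing_extₗ (hU : Bornology.IsBounded (U : Set (Eu d))) :
    IsInducing (BDot.extₗ s hU) := by
  refine ⟨(BDot.topology_eq_iInf id fun h => ⟨h, le_rfl⟩).trans ?_⟩
  change _ = TopologicalSpace.induced _ (⨅ h, _)
  rw [induced_iInf]
  refine iInf_congr fun h => ?_
  rw [induced_compose]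
  change _ = TopologicalSpace.induced (extComp s h hU ∘ BDot.proj s U h) _
  rw [← induced_compose, ← (extComp s h hU).isometry.isUniformInducing.isInducing.eq_induced]
  rfl

/-- A point of the closure of the range projects, at every level `h`, into the closed range of
`extComp`. The preimages obtained there all have the same underlying function, which therefore comes
from `Ḃ^{(s)}(U)`. -/
theorem isClosedEmbedding_extₗ (hU : Bornology.IsBounded (U : Set (Eu d))) :
    IsClosedEmbedding (BDot.extₗ s hU) := by
  refine ⟨⟨isInducing_extₗ hU, fun φ ψ hφψ => BDot.ext ?_⟩, ?_⟩
  · have h1 : zeroExt U φ.1.fn = zeroExt U ψ.1.fn := congrArg BeurlingComp.fn hφψ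
    funext x
    rw [← zeroExt_apply φ.1.fn, h1, zeroExt_apply]
  · refine isClosed_of_closure_subset fun f hf => ?_
    have h1 : ∀ h, ∃ φ : LpClosure s ⊤ h U, zeroExt U φ.1.fn = f.fn := fun h => by
      have hc : Continuous (BeurlingComp.incl s (closure (U : Set (Eu d))) h) :=
        continuous_iInf_dom continuous_induced_dom
      have h2 : BeurlingComp.incl s _ h f ∈ closure (Set.range (extComp s h hU)) :=
        map_mem_closure hc hf (by
          rintro _ ⟨φ, rfl⟩
          exact ⟨BDot.proj s U h φ, rfl⟩)
      rw [(isClosed_range_extComp hU).closure_eq] at h2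
      obtain ⟨φ, hφ⟩ := h2
      exact ⟨φ, congrArg Comp.fn hφ⟩
    obtain ⟨φ, hφ⟩ := exists_of_forall_mem (s := s) (U := U) (f := fun x => f.fn x) fun h => by
      obtain ⟨φ, hφ⟩ := h1 h
      exact ⟨φ, funext fun x => by rw [← hφ, zeroExt_apply]⟩
    refine ⟨φ, Subtype.ext ?_⟩
    obtain ⟨ψ, hψ⟩ := h1 ⟨1, Set.mem_Ioi.2 one_pos⟩
    change zeroExt U φ.1.fn = f.fn
    rw [hφ]
    exact zeroExt_restrict fun x hx => by rw [← hψ, zeroExt_of_notMem _ hx]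

end Gevrey

/-! ### A criterion for nuclearity by factorization through `ℓ²`. -/

section NuclearCriterion

variable {E : Type*} [AddCommGroup E] [Module ℂ E]

/-- A linear map into a Banach space that is bounded by a linear map into a Hilbert space factors
through the Hilbert space. -/
theorem exists_continuousLinearMap_comp_eq {H F : Type*} [NormedAddCommGroup H]
    [InnerProductSpace ℂ H] [CompleteSpace H] [NormedAddCommGroup F] [NormedSpace ℂ F]
    [CompleteSpace F] (J : E →ₗ[ℂ] H) (T : E →ₗ[ℂ] F) {C : ℝ} (hT : ∀ x, ‖T x‖ ≤ C * ‖J x‖) :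
    ∃ A : H →L[ℂ] F, ∀ x, A (J x) = T x := by
  set S : Submodule ℂ H := (LinearMap.range J).topologicalClosure
  have hS : ∀ x, J x ∈ S := fun x => Submodule.le_topologicalClosure _ (LinearMap.mem_range_self J x)
  let e : E →ₗ[ℂ] S := J.codRestrict S hS
  have : CompleteSpace S := (Submodule.isClosed_topologicalClosure _).completeSpace_coe
  have hd : DenseRange e := by
    rw [DenseRange, dense_iff_closure_eq, Set.eq_univ_iff_forall]
    intro y
    rw [closure_subtype]
    have h1 : Subtype.val '' Set.range e = (LinearMap.range J : Set H) := by
      ext z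
      simp [e]
    rw [h1]
    exact y.2
  -- `T` extends by density to the closure of the range of `J`. The orthogonal projection then
  -- extends it to all of `H`; this is where a Hilbert space is needed.
  refine ⟨(T.extendOfNorm e).comp S.orthogonalProjectionOnto, fun x => ?_⟩
  have h2 : S.orthogonalProjectionOnto (J x) = e x :=
    Submodule.orthogonalProjectionOnto_mem_subspace_eq_self (e x)
  rw [ContinuousLinearMap.comp_apply, h2]
  exact LinearMap.extendOfNorm_eq hd ⟨C, hT⟩ x

theorem norm_toLocalBanach (q : Seminorm ℂ E) (x : E) : ‖toLocalBanach q x‖ = q x :=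
  UniformSpace.Completion.norm_coe (E := SeminormSpace q) x

theorem extend_zero_of_notMem_range {ι β : Type*} [Zero β] {g : ι → ℕ} (u : ι → β) {n : ℕ}
    (hn : n ∉ Set.range g) : Function.extend g u 0 n = 0 :=
  Function.extend_apply' _ _ _ fun ⟨i, hi⟩ => hn ⟨i, hi⟩

/-- A nuclear representation indexed by a countable set. -/
theorem IsNuclearMap.of_countable [TopologicalSpace E] {F : Type*} [NormedAddCommGroup F]
    [NormedSpace ℂ F] {T : E →ₗ[ℂ] F} {ι : Type*} [Countable ι] (c : ι → ℂ) (f : ι → E →ₗ[ℂ] ℂ)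
    (y : ι → F) (hc : Summable fun i => ‖c i‖)
    (r : Seminorm ℂ E) (hr : Continuous r) (hf : ∀ i x, ‖f i x‖ ≤ r x)
    (hy : ∀ i, ‖y i‖ ≤ 1) (hT : ∀ x, HasSum (fun i => (c i * f i x) • y i) (T x)) :
    IsNuclearMap T := by
  obtain ⟨g, hg⟩ := exists_injective_nat ι
  refine ⟨Function.extend g c 0, Function.extend g f 0, Function.extend g y 0, ?_,
    ⟨r, hr, fun n x => ?_⟩, fun n => ?_, fun x => ?_⟩
  · refine (hg.summable_iff fun n hn => ?_).1 ?_
    · rw [extend_zero_of_notMem_range c hn, norm_zero]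
    · simpa [Function.comp_def, hg.extend_apply] using hc
  · by_cases hn : n ∈ Set.range g
    · obtain ⟨i, rfl⟩ := hn
      rw [hg.extend_apply]; exact hf i x
    · rw [extend_zero_of_notMem_range f hn]; simp
  · by_cases hn : n ∈ Set.range g
    · obtain ⟨i, rfl⟩ := hn
      rw [hg.extend_apply]; exact hy i
    · rw [extend_zero_of_notMem_range y hn]; simp
  · refine (hg.hasSum_iff fun n hn => ?_).1 ?_
    · rw [extend_zero_of_notMem_range c hn, zero_mul, zero_smul]
    · simpa [Function.comp_def, hg.extend_apply] using hT x

/-- A seminorm that is dominated by the supremum of countably many functionals that are summably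
bounded by a continuous seminorm has a nuclear canonical map. -/
theorem isNuclearMap_toLocalBanach [TopologicalSpace E] {ι : Type*} [Countable ι]
    {q r : Seminorm ℂ E} (hr : Continuous r) (a : ι → E →ₗ[ℂ] ℂ) {b : ι → ℝ} (hb0 : ∀ i, 0 ≤ b i)
    (hb : Summable b) (hab : ∀ i x, ‖a i x‖ ≤ b i * r x) {C : ℝ}
    (hq : ∀ x D, 0 ≤ D → (∀ i, ‖a i x‖ ≤ D) → q x ≤ C * D) :
    IsNuclearMap (toLocalBanach q) := by
  classical
  -- The bounds `b i * r x` put the family in `ℓ¹`, and `ℓ¹ ⊆ ℓ²`.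
  have hmem : ∀ x, Memℓp (fun i => a i x) 2 := fun x => by
    refine Memℓp.of_exponent_ge (p := 2) (q := 1) ?_ one_le_two
    refine memℓp_gen ?_
    simpa using (hb.mul_right (r x)).of_nonneg_of_le (fun _ => norm_nonneg _) fun i => hab i x
  let J : E →ₗ[ℂ] lp (fun _ : ι => ℂ) 2 :=
    { toFun := fun x => ⟨fun i => a i x, hmem x⟩
      map_add' := fun x y => by ext i; exact (a i).map_add x y
      map_smul' := fun c x => by ext i; exact (a i).map_smul c x }
  have hJ : ∀ i x, J x i = a i x := fun i x => rfl
  obtain ⟨A, hA⟩ := exists_continuousLinearMap_comp_eq J (toLocalBanach q) (C := C) fun x => by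
    rw [norm_toLocalBanach]
    exact hq x _ (norm_nonneg _) fun i => lp.norm_apply_le_norm (by norm_num) (J x) i
  -- `M` normalizes the vectors `A (v i)` into the unit ball; adding `1` keeps it nonzero when `A =
  -- 0`.
  set M : ℝ := ‖A‖ + 1 with hM
  have hM0 : 0 < M := by positivity
  have hMc : (M : ℂ) ≠ 0 := by exact_mod_cast hM0.ne'
  let v : ι → lp (fun _ : ι => ℂ) 2 := fun i => lp.single 2 i (1 : ℂ)
  refine IsNuclearMap.of_countable (fun i => ((M * b i : ℝ) : ℂ)) (fun i => ((b i : ℂ)⁻¹) • a i)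
    (fun i => (M : ℂ)⁻¹ • A (v i)) ?_ r hr (fun i x => ?_) (fun i => ?_) (fun x => ?_)
  · simpa [abs_of_nonneg (hb0 _), abs_of_pos hM0] using hb.mul_left M
  · rw [LinearMap.smul_apply, norm_smul, norm_inv, Complex.norm_real, Real.norm_of_nonneg (hb0 i)]
    rcases (hb0 i).eq_or_lt with h | h
    · rw [← h]; simp
    · rw [inv_mul_le_iff₀ h]; exact hab i x
  · rw [norm_smul, norm_inv, Complex.norm_real, Real.norm_of_nonneg hM0.le, inv_mul_le_iff₀ hM0]
    have h1 : ‖v i‖ = 1 := by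
      rw [lp.norm_single (by norm_num)]; simp
    have h2 := A.le_opNorm (v i)
    rw [h1] at h2
    linarith
  · rw [← hA x]
    refine ((lp.hasSum_single (by norm_num) (J x)).map A A.continuous).congr_fun fun i => ?_
    have h1 : lp.single 2 i (J x i) = J x i • v i := by
      rw [← lp.single_smul, smul_eq_mul, mul_one]
    have h2 : ((M * b i : ℝ) : ℂ) * ((b i : ℂ)⁻¹ • a i) x * (M : ℂ)⁻¹ = J x i := by
      rw [LinearMap.smul_apply, smul_eq_mul, hJ]
      -- If `b i = 0` then `(b i)⁻¹ = 0`, and the identity survives because `hab` forces `a i x =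
      -- 0`.
      rcases (hb0 i).eq_or_lt with h | h
      · have h3 := hab i x
        rw [← h, zero_mul, norm_le_zero_iff] at h3
        simp [h3]
      · have : (b i : ℂ) ≠ 0 := by exact_mod_cast h.ne'
        push_cast
        field_simp
    rw [Function.comp_apply, h1, map_smul, smul_smul, h2]

end NuclearCriterion

namespace Gevrey

variable {d : ℕ}

/-! ### Sampling on grids -/

/-- The points of a grid with `N^d` points in the cube of half side length `R`. -/
def gridPt (R : ℝ) {N : ℕ} (k : Fin d → Fin N) : Eu d :=
  WithLp.toLp 2 fun j => -R + 2 * R * (k j : ℝ) / N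

theorem norm_le_of_forall_abs_le {v : Eu d} {c : ℝ} (H : ∀ j, |v j| ≤ c) : ‖v‖ ≤ d * c := by
  rw [← sum_basisVec v]
  refine (norm_sum_le _ _).trans ?_
  calc ∑ j, ‖v j • basisVec j‖ ≤ ∑ _j : Fin d, c :=
        Finset.sum_le_sum fun j _ => by simpa [norm_smul, basisVec] using H j
    _ = d * c := by simp

/-- Each coordinate is rounded down to the grid. The strict bound `x j < R` keeps the resulting
index below `N`. -/
theorem exists_gridPt_near {R : ℝ} (hR : 0 < R) {N : ℕ} (hN : 0 < N) {x : Eu d}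
    (hx : ∀ j, |x j| < R) : ∃ k : Fin d → Fin N, ‖x - gridPt R k‖ ≤ d * (2 * R / N) := by
  have hN' : (0 : ℝ) < N := by exact_mod_cast hN
  have h1 : ∀ j, ∃ m : Fin N, |x j - (-R + 2 * R * (m : ℝ) / N)| ≤ 2 * R / N := fun j => by
    obtain ⟨h2, h3⟩ := abs_lt.1 (hx j)
    set z := (x j + R) * N / (2 * R) with hz
    have hz0 : 0 ≤ z := by
      have : 0 < x j + R := by linarith
      positivity
    have hzN : z < N := by
      rw [hz, div_lt_iff₀ (by positivity)]
      nlinarith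
    have hxz : x j = -R + 2 * R * z / N := by
      rw [hz]; field_simp; ring
    refine ⟨⟨⌊z⌋₊, (Nat.floor_lt hz0).2 hzN⟩, ?_⟩
    have h4 := Nat.floor_le hz0
    have h5 := Nat.lt_floor_add_one z
    have h6 : x j - (-R + 2 * R * (⌊z⌋₊ : ℝ) / N) = 2 * R / N * (z - ⌊z⌋₊) := by
      rw [hxz]; ring
    change |x j - (-R + 2 * R * (⌊z⌋₊ : ℝ) / N)| ≤ _
    rw [h6, abs_of_nonneg (mul_nonneg (by positivity) (by linarith))]
    exact mul_le_of_le_one_right (by positivity) (by linarith)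
  choose k hk using h1
  exact ⟨k, norm_le_of_forall_abs_le fun j => hk j⟩

theorem prod_factorial_add_single (α : Fin d → ℕ) (j : Fin d) :
    ∏ i, ((α + Pi.single j 1 : Fin d → ℕ) i).factorial = (∏ i, (α i).factorial) * (α j + 1) := by
  rw [← Finset.mul_prod_erase _ _ (Finset.mem_univ j),
    ← Finset.mul_prod_erase _ (fun i => (α i).factorial) (Finset.mem_univ j)]
  have : ∏ i ∈ Finset.univ.erase j, ((α + Pi.single j 1 : Fin d → ℕ) i).factorial =
      ∏ i ∈ Finset.univ.erase j, (α i).factorial :=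
    Finset.prod_congr rfl fun i hi => by simp [(Finset.mem_erase.1 hi).1]
  rw [this]
  simp [Nat.factorial_succ]
  ring

theorem weight_add_single (s h : ℝ) (α : Fin d → ℕ) (j : Fin d) :
    weight s h (α + Pi.single j 1) = weight s h α * (h / ((α j : ℝ) + 1) ^ s) := by
  unfold weight
  rw [prod_factorial_add_single, Nat.cast_mul, Real.mul_rpow (by positivity) (by positivity)]
  have : ∑ i, (α + Pi.single j 1 : Fin d → ℕ) i = (∑ i, α i) + 1 := by
    simp [Finset.sum_add_distrib]
  rw [this, pow_succ]
  push_cast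
  rw [mul_div_mul_comm]

/-- `α j + 1 ≤ 2^{α j} ≤ 2^{|α|}`. The Gevrey loss of one derivative is thus absorbed by a grid
whose fineness is geometric in the order. -/
theorem succ_rpow_le {s : ℝ} (hs : 0 ≤ s) {A : ℕ} (hA : (2 : ℝ) ^ s ≤ A) (α : Fin d → ℕ)
    (j : Fin d) : ((α j : ℝ) + 1) ^ s ≤ (A : ℝ) ^ (∑ i, α i) := by
  have h1 : α j + 1 ≤ 2 ^ (∑ i, α i) :=
    (Nat.succ_le_of_lt Nat.lt_two_pow_self).trans
      (Nat.pow_le_pow_right (by norm_num) (Finset.single_le_sum (fun _ _ => Nat.zero_le _)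
        (Finset.mem_univ j)))
  have h2 : (α j : ℝ) + 1 ≤ (2 : ℝ) ^ (∑ i, α i) := by exact_mod_cast h1
  calc ((α j : ℝ) + 1) ^ s ≤ ((2 : ℝ) ^ (∑ i, α i)) ^ s :=
        Real.rpow_le_rpow (by positivity) h2 hs
    _ = ((2 : ℝ) ^ s) ^ (∑ i, α i) := by
        rw [← Real.rpow_natCast, ← Real.rpow_natCast, ← Real.rpow_mul (by norm_num),
          ← Real.rpow_mul (by norm_num), mul_comm]
    _ ≤ _ := by gcongr

/-- The norm of `D^{s,h}_K` is controlled by the values of the derivatives at grid points; for the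
derivatives of order `n` a grid of `(N₀ A^n)^d` points is sufficient. -/
theorem Comp.norm_le_of_grid {s : ℝ} (hs : 0 ≤ s) {h : Set.Ioi (0 : ℝ)} {K : Set (Eu d)} {R : ℝ}
    (hR : 0 < R) (hK : ∀ x ∈ K, ∀ j, |x j| < R) {A N₀ : ℕ} (hA : (2 : ℝ) ^ s ≤ A) (hN₀ : 0 < N₀)
    (hN : 4 * d * d * R ≤ h.1 * N₀) (f : Comp s h K) {C : ℝ} (hC : 0 ≤ C)
    (H : ∀ (α : Fin d → ℕ) (k : Fin d → Fin (N₀ * A ^ ∑ i, α i)),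
      weight s h.1 α * ‖pderiv α f.fn (gridPt R k)‖ ≤ C) : ‖f‖ ≤ 2 * C := by
  have hh : 0 < h.1 := h.2
  have hA0 : (0 : ℝ) < A := lt_of_lt_of_le (by positivity) hA
  have hA0' : 0 < A := by exact_mod_cast hA0
  -- The error term is absorbed into the left-hand side, which is legitimate because `‖f‖` is
  -- finite.
  have key : ‖f‖ ≤ C + ‖f‖ / 2 := by
    refine f.norm_le (by positivity) fun α x => ?_
    by_cases hx : x ∈ K
    · have hw := weight_pos s hh α
      set n := ∑ i, α i
      obtain ⟨k, hk⟩ := exists_gridPt_near hR (N := N₀ * A ^ n) (by positivity) (hK x hx)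
      have hD : ∀ j y, ‖pderiv (α + Pi.single j 1) f.fn y‖ ≤
          (A : ℝ) ^ n / (weight s h.1 α * h.1) * ‖f‖ := fun j y => by
        have h1 := f.weight_mul_norm_le (α + Pi.single j 1) y
        rw [weight_add_single] at h1
        have h2 := succ_rpow_le hs hA α j
        have h3 : (0 : ℝ) < ((α j : ℝ) + 1) ^ s := by positivity
        calc ‖pderiv (α + Pi.single j 1) f.fn y‖
            ≤ ((α j : ℝ) + 1) ^ s / (weight s h.1 α * h.1) * ‖f‖ := by
              rw [div_mul_eq_mul_div, le_div_iff₀ (by positivity)]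
              rw [mul_comm, ← div_le_iff₀' h3]
              refine le_trans (le_of_eq ?_) h1
              ring
          _ ≤ _ := by gcongr
      have h4 := norm_pderiv_sub_le f.2.1 α hD x (gridPt R k)
      have h5 : ‖pderiv α f.fn x‖ ≤ ‖pderiv α f.fn (gridPt R k)‖ +
          d * ((A : ℝ) ^ n / (weight s h.1 α * h.1) * ‖f‖) * (d * (2 * R / (N₀ * A ^ n : ℕ))) := by
        have h6 := norm_le_norm_add_norm_sub' (pderiv α f.fn x) (pderiv α f.fn (gridPt R k))
        refine h6.trans (add_le_add_right (h4.trans ?_) _)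
        gcongr
      calc weight s h.1 α * ‖pderiv α f.fn x‖
          ≤ weight s h.1 α * (‖pderiv α f.fn (gridPt R k)‖ + d * ((A : ℝ) ^ n /
            (weight s h.1 α * h.1) * ‖f‖) * (d * (2 * R / (N₀ * A ^ n : ℕ)))) := by gcongr
        -- The factor `A^n` in the derivative bound cancels against the mesh size; what is left is
        -- at most `‖f‖ / 2` by `hN`, uniformly in `α`.
        _ = weight s h.1 α * ‖pderiv α f.fn (gridPt R k)‖ +
            (4 * d * d * R) / (h.1 * N₀) * (‖f‖ / 2) := by
            push_cast
            field_simp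
            ring
        _ ≤ C + ‖f‖ / 2 := by
            refine add_le_add (H α k) (mul_le_of_le_one_left (by positivity) ?_)
            rw [div_le_one (by positivity)]
            exact hN
    · have h0 : pderiv α f.fn x = 0 :=
        pderiv_eq_zero_of_notMem_tsupport (fun h' => hx (f.2.2.1 h')) α
      rw [h0, norm_zero, mul_zero]
      positivity
  linarith

theorem summable_pow_sum {θ : ℝ} (h0 : 0 ≤ θ) (h1 : θ < 1) (d : ℕ) :
    Summable fun α : Fin d → ℕ => θ ^ ∑ j, α j := by
  induction d with
  | zero => exact (hasSum_fintype _).summable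
  | succ d ih =>
    rw [← (Fin.consEquiv fun _ : Fin (d + 1) => ℕ).summable_iff]
    have := (summable_geometric_of_lt_one h0 h1).mul_of_nonneg ih (fun _ => by positivity)
      (fun _ => by positivity)
    refine this.congr fun p => ?_
    simp [Fin.consEquiv, Fin.sum_univ_succ, pow_add]

/-- The weighted numbers of grid points are summable. -/
theorem summable_grid {d : ℕ} {N₀ A : ℕ} {ρ : ℝ} (hρ : 0 ≤ ρ) (hρA : (A : ℝ) ^ d * ρ < 1) :
    Summable fun i : (Σ α : Fin d → ℕ, (Fin d → Fin (N₀ * A ^ ∑ j, α j))) => ρ ^ ∑ j, i.1 j := by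
  rw [summable_sigma_of_nonneg fun _ => by positivity]
  refine ⟨fun α => (hasSum_fintype _).summable, ?_⟩
  -- For fixed `α` the inner sum is `(N₀ A^{|α|})^d ρ^{|α|} = N₀^d (A^d ρ)^{|α|}`.
  have := (summable_pow_sum (by positivity) hρA d).mul_left ((N₀ : ℝ) ^ d)
  refine this.congr fun α => ?_
  simp
  rw [mul_pow, mul_pow, ← pow_mul, ← pow_mul, mul_comm (∑ j, α j) d]
  ring

end Gevrey

namespace Gevrey

variable {d : ℕ} {s : ℝ} {U : Opens (Eu d)}

/-! ### Weighted samples as linear functionals. -/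

/-- The weighted value of `∂^α f` at a point, as a linear functional on `D^{s,h}_K`. -/
def Comp.sample {h : Set.Ioi (0 : ℝ)} {K : Set (Eu d)} (α : Fin d → ℕ) (y : Eu d) :
    Comp s h K →ₗ[ℂ] ℂ where
  toFun f := (weight s h.1 α : ℂ) * pderiv α f.fn y
  map_add' f g := by
    have h1 : pderiv α (f + g).fn y = pderiv α f.fn y + pderiv α g.fn y :=
      pderiv_add α f.2.1.contDiffAt g.2.1.contDiffAt
    rw [h1, mul_add]
  map_smul' c f := by
    have h1 : pderiv α (c • f).fn y = c * pderiv α f.fn y :=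
      pderiv_smul α c f.2.1.contDiffAt
    rw [h1, RingHom.id_apply, smul_eq_mul]
    ring

theorem Comp.norm_sample {h : Set.Ioi (0 : ℝ)} {K : Set (Eu d)} (α : Fin d → ℕ) (y : Eu d)
    (f : Comp s h K) : ‖Comp.sample α y f‖ = weight s h.1 α * ‖pderiv α f.fn y‖ := by
  change ‖(weight s h.1 α : ℂ) * pderiv α f.fn y‖ = _
  rw [norm_mul, Complex.norm_real, Real.norm_of_nonneg (weight_pos s h.2 α).le]

theorem Comp.norm_sample_le {h : Set.Ioi (0 : ℝ)} {K : Set (Eu d)} (α : Fin d → ℕ) (y : Eu d)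
    (f : Comp s h K) : ‖Comp.sample α y f‖ ≤ ‖f‖ := by
  rw [Comp.norm_sample]; exact f.weight_mul_norm_le α y

theorem weight_eq_mul (s : ℝ) (h : ℝ) {h₁ : ℝ} (hh₁ : h₁ ≠ 0) (α : Fin d → ℕ) :
    weight s h α = (h / h₁) ^ (∑ j, α j) * weight s h₁ α := by
  unfold weight
  rw [div_pow]
  field_simp

/-- Lowering `h` improves the bounds on the derivatives of high order. -/
theorem Comp.norm_sample_le_of_fn_eq {h h₁ : Set.Ioi (0 : ℝ)} {K : Set (Eu d)} (α : Fin d → ℕ)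
    (y : Eu d) {f : Comp s h K} {g : Comp s h₁ K} (hfg : f.fn = g.fn) :
    ‖Comp.sample α y f‖ ≤ (h.1 / h₁.1) ^ (∑ j, α j) * ‖g‖ := by
  have h1 : 0 < h₁.1 := h₁.2
  have h0 : 0 < h.1 := h.2
  rw [Comp.norm_sample, hfg, weight_eq_mul s h.1 h1.ne', mul_assoc]
  gcongr
  exact g.weight_mul_norm_le α y

/-- The samples of an element of `D^{(s)}_{L^∞,h}(U)`. -/
def sampleClosure {h : Set.Ioi (0 : ℝ)} (hU : Bornology.IsBounded (U : Set (Eu d)))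
    (α : Fin d → ℕ) (y : Eu d) : LpClosure s ⊤ h U →ₗ[ℂ] ℂ :=
  (Comp.sample α y).comp (extComp s h hU).toLinearMap

theorem norm_sampleClosure_le {h : Set.Ioi (0 : ℝ)} (hU : Bornology.IsBounded (U : Set (Eu d)))
    (α : Fin d → ℕ) (y : Eu d) (φ : LpClosure s ⊤ h U) : ‖sampleClosure hU α y φ‖ ≤ ‖φ‖ := by
  rw [← (extComp s h hU).norm_map φ]
  exact Comp.norm_sample_le α y (extComp s h hU φ)

theorem norm_sampleClosure_le_of_fn_eq {h h₁ : Set.Ioi (0 : ℝ)}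
    (hU : Bornology.IsBounded (U : Set (Eu d))) (α : Fin d → ℕ) (y : Eu d)
    {φ : LpClosure s ⊤ h U} {ψ : LpClosure s ⊤ h₁ U} (hφψ : φ.1.fn = ψ.1.fn) :
    ‖sampleClosure hU α y φ‖ ≤ (h.1 / h₁.1) ^ (∑ j, α j) * ‖ψ‖ := by
  rw [← (extComp s h₁ hU).norm_map ψ]
  refine Comp.norm_sample_le_of_fn_eq α y (f := extComp s h hU φ) (g := extComp s h₁ hU ψ) ?_
  rw [extComp_fn, extComp_fn, hφψ]

theorem exists_cube_of_isBounded {S : Set (Eu d)} (hS : Bornology.IsBounded S) :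
    ∃ R : ℝ, 0 < R ∧ ∀ x ∈ closure S, ∀ j, |x j| < R := by
  obtain ⟨R, hR⟩ := hS.closure.exists_norm_le
  refine ⟨|R| + 1, by positivity, fun x hx j => ?_⟩
  have h1 := hR x hx
  have h2 := norm_apply_le x j
  have h3 := le_abs_self R
  linarith

theorem exists_grid_norm_le (hs : 0 ≤ s) (hU : Bornology.IsBounded (U : Set (Eu d)))
    (h : Set.Ioi (0 : ℝ)) : ∃ (R : ℝ) (A N₀ : ℕ), 0 < A ∧
      ∀ (φ : LpClosure s ⊤ h U) (C : ℝ), 0 ≤ C →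
        (∀ (α : Fin d → ℕ) (k : Fin d → Fin (N₀ * A ^ ∑ i, α i)),
          ‖sampleClosure hU α (gridPt R k) φ‖ ≤ C) → ‖φ‖ ≤ 2 * C := by
  obtain ⟨R, hR, hRU⟩ := exists_cube_of_isBounded hU
  have hh : 0 < h.1 := h.2
  -- `A` dominates `2^s` and `N₀` satisfies `4 d² R ≤ h N₀`; the added `1` keeps `N₀` positive also
  -- for `d = 0`.
  refine ⟨R, ⌈(2 : ℝ) ^ s⌉₊, ⌈4 * d * d * R / h.1⌉₊ + 1, Nat.ceil_pos.2 (by positivity),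
    fun φ C hC H => ?_⟩
  rw [← (extComp s h hU).norm_map φ]
  refine Comp.norm_le_of_grid hs hR hRU (N₀ := ⌈4 * d * d * R / h.1⌉₊ + 1) (Nat.le_ceil _)
    (Nat.succ_pos _) ?_ _ hC fun α k => ?_
  · rw [← div_le_iff₀' hh]
    push_cast
    linarith [Nat.le_ceil (4 * d * d * R / h.1)]
  · rw [← Comp.norm_sample]
    exact H α k

/-! ### Compactness of the linking maps -/

/-- The image of the unit ball is totally bounded: finitely many low-order samples range over a
bounded set in finite dimension, and the remaining ones are uniformly small by the gain from `h₁` to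
`h`. -/
theorem isCompactOperator_linkClosure (hs : 0 ≤ s) (hU : Bornology.IsBounded (U : Set (Eu d)))
    {h h₁ : Set.Ioi (0 : ℝ)} (hlt : h < h₁) :
    IsCompactOperator (linkClosure s U hlt.le) := by
  have hh : 0 < h.1 := h.2
  have hh₁ : 0 < h₁.1 := h₁.2
  have : CompleteSpace (LpClosure s ⊤ h U) := completeSpace_lpClosure hU
  refine (isCompactOperator_iff_isCompact_closure_image_ball
    (linkClosure s U hlt.le).toLinearMap one_pos).2 ?_
  refine (Metric.totallyBounded_of_finite_discretization fun ε hε => ?_).closure.isCompact_of_isClosed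
    isClosed_closure
  obtain ⟨R, A, N₀, -, hgrid⟩ := exists_grid_norm_le hs hU h
  set ρ := h.1 / h₁.1
  have hρ0 : 0 ≤ ρ := by positivity
  have hρ1 : ρ < 1 := (div_lt_one hh₁).2 hlt
  -- Budget: a common `ε/8`-net centre makes low-order samples of a difference smaller than `ε/4`,
  -- and `2 ρ^n < ε/4` handles the others. The grid inequality doubles this to `ε/2 < ε`.
  obtain ⟨n, hn⟩ := exists_pow_lt_of_lt_one (show 0 < ε / 8 by positivity) hρ1
  let J := Σ α : Fin d → Fin n, (Fin d → Fin (N₀ * A ^ ∑ i, (α i : ℕ)))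
  let Λ : LpClosure s ⊤ h U →ₗ[ℂ] (J → ℂ) :=
    LinearMap.pi fun i => sampleClosure hU (fun j => (i.1 j : ℕ)) (gridPt R i.2)
  have hΛ : ∀ φ : LpClosure s ⊤ h U, ‖Λ φ‖ ≤ ‖φ‖ := fun φ =>
    (pi_norm_le_iff_of_nonneg (norm_nonneg _)).2 fun i => norm_sampleClosure_le hU _ _ φ
  obtain ⟨t, ht, htc⟩ := Metric.totallyBounded_iff.1
    (isCompact_closedBall (0 : J → ℂ) 1).totallyBounded (ε / 8) (by positivity)
  have himage : ∀ x : (linkClosure s U hlt.le).toLinearMap '' Metric.ball 0 1,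
      ∃ φ : LpClosure s ⊤ h₁ U, ‖φ‖ < 1 ∧ linkClosure s U hlt.le φ = x.1 := fun x => by
    obtain ⟨φ, hφ, hφx⟩ := x.2
    exact ⟨φ, mem_ball_zero_iff.1 hφ, hφx⟩
  have hfar : ∀ x : (linkClosure s U hlt.le).toLinearMap '' Metric.ball 0 1,
      ∃ c : t, dist (Λ x.1) c.1 < ε / 8 := fun x => by
    obtain ⟨φ, hφ, hφx⟩ := himage x
    have h1 : ‖Λ x.1‖ ≤ 1 := by
      refine (hΛ _).trans ?_
      rw [← hφx]
      exact (LpSpace.norm_linkₗ_le hlt.le φ.1).trans hφ.le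
    obtain ⟨c, hc, hcd⟩ := Set.mem_iUnion₂.1 (htc (mem_closedBall_zero_iff.2 h1))
    exact ⟨⟨c, hc⟩, hcd⟩
  choose F hF using hfar
  refine ⟨t, ht.fintype, F, fun x y hxy => ?_⟩
  obtain ⟨φ, hφ, hφx⟩ := himage x
  obtain ⟨ψ, hψ, hψy⟩ := himage y
  have hd : dist (Λ x.1) (Λ y.1) < ε / 4 := by
    have h1 := hF x
    have h2 := hF y
    rw [hxy] at h1
    have h3 := dist_triangle_right (Λ x.1) (Λ y.1) (F y).1
    linarith
  have hsub : x.1 - y.1 = linkClosure s U hlt.le (φ - ψ) := by rw [map_sub, hφx, hψy]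
  have hnorm : ‖φ - ψ‖ ≤ 2 := (norm_sub_le _ _).trans (by linarith)
  have key : ‖x.1 - y.1‖ ≤ 2 * (ε / 4) := by
    refine hgrid _ _ (by positivity) fun α k => ?_
    -- Low order means lying in the cube `[0,n)^d`; outside it some `α j ≥ n`, hence `|α| ≥ n`.
    by_cases hα : ∀ j, α j < n
    · have h1 : ‖Λ (x.1 - y.1)‖ < ε / 4 := by rwa [map_sub, ← dist_eq_norm]
      exact (norm_le_pi_norm (Λ (x.1 - y.1)) ⟨fun j => ⟨α j, hα j⟩, k⟩).trans h1.le
    · push Not at hα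
      obtain ⟨j, hj⟩ := hα
      have hle : n ≤ ∑ j, α j :=
        hj.trans (Finset.single_le_sum (fun _ _ => Nat.zero_le _) (Finset.mem_univ j))
      have h1 : (x.1 - y.1).1.fn = (φ - ψ).1.fn := by rw [hsub]; exact linkClosure_fn _ _
      refine (norm_sampleClosure_le_of_fn_eq hU α _ h1).trans ?_
      have h2 : ρ ^ (∑ j, α j) ≤ ε / 8 := (pow_le_pow_of_le_one hρ0 hρ1.le hle).trans hn.le
      calc ρ ^ (∑ j, α j) * ‖φ - ψ‖ ≤ ε / 8 * 2 := by gcongr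
        _ = ε / 4 := by ring
  rw [dist_eq_norm]
  change ‖x.1 - y.1‖ < ε
  linarith

/-! ### Nuclearity -/

theorem exists_ball_subset_of_mem_nhds_zero {O : Set (BDot s U)} (hO : O ∈ 𝓝 (0 : BDot s U)) :
    ∃ (h : Set.Ioi (0 : ℝ)) (ε : ℝ), 0 < ε ∧ ∀ φ, ‖BDot.proj s U h φ‖ < ε → φ ∈ O := by
  obtain ⟨O', hO', hsub⟩ := mem_nhds_subtype _ _ _ |>.1 hO
  obtain ⟨h, ε, hε, H⟩ := exists_ball_subset_of_mem_nhds hO'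
  refine ⟨h, ε, hε, fun φ hφ => hsub (H φ.1 ?_)⟩
  rw [ZeroMemClass.coe_zero, map_zero, sub_zero]
  exact hφ

/-- The norm of `D^{(s)}_{L^∞,h}(U)` as a seminorm on `Ḃ^{(s)}(U)`. -/
def BDot.seminorm (s : ℝ) (U : Opens (Eu d)) (h : Set.Ioi (0 : ℝ)) : Seminorm ℂ (BDot s U) :=
  (normSeminorm ℂ (LpClosure s ⊤ h U)).comp (BDot.proj s U h).toLinearMap

theorem BDot.continuous_seminorm (h : Set.Ioi (0 : ℝ)) : Continuous (BDot.seminorm s U h) :=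
  (BDot.proj s U h).continuous.norm

theorem exists_le_seminorm {q : Seminorm ℂ (BDot s U)} (hq : Continuous q) :
    ∃ (h : Set.Ioi (0 : ℝ)) (C : ℝ), 0 ≤ C ∧ ∀ φ, q φ ≤ C * ‖BDot.proj s U h φ‖ := by
  have hO : {φ | q φ < 1} ∈ 𝓝 (0 : BDot s U) :=
    (isOpen_lt hq continuous_const).mem_nhds (by simp)
  obtain ⟨h, ε, hε, H⟩ := exists_ball_subset_of_mem_nhds_zero hO
  refine ⟨h, ε⁻¹, by positivity, fun φ => le_of_forall_pos_le_add fun δ hδ => ?_⟩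
  set N := ‖BDot.proj s U h φ‖
  have hN : 0 ≤ N := norm_nonneg _
  -- Scaling just inside the ball of radius `ε`: `1 / t = ε⁻¹ N + δ`, and the `δ` covers the case `N
  -- = 0`.
  set t : ℝ := ε / (N + δ * ε) with ht
  have ht0 : 0 < t := by positivity
  have h1 : q ((t : ℂ) • φ) < 1 := H _ (by
    rw [map_smul, norm_smul, Complex.norm_real, Real.norm_of_nonneg ht0.le]
    change t * N < ε
    rw [ht, div_mul_eq_mul_div, div_lt_iff₀ (by positivity)]
    have : 0 < δ * ε := by positivity
    nlinarith)
  rw [map_smul_eq_mul, Complex.norm_real, Real.norm_of_nonneg ht0.le, ← lt_div_iff₀' ht0] at h1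
  refine h1.le.trans (le_of_eq ?_)
  rw [ht]
  field_simp

theorem isNuclearSpace_BDot (hs : 0 ≤ s) (hU : Bornology.IsBounded (U : Set (Eu d))) :
    IsNuclearSpace (BDot s U) := by
  have hlim := isTVSProjectiveLimit_BDot (s := s) (U := U) (H := id) monotone_id
    fun h => ⟨h, le_rfl⟩
  refine ⟨hlim.isEmbedding.t2Space, inferInstance, inferInstance, fun V hV => ?_, fun q hq => ?_⟩
  · obtain ⟨h, ε, hε, H⟩ := exists_ball_subset_of_mem_nhds_zero hV
    refine ⟨(normSeminorm ℂ (LpClosure s ⊤ h U)).comp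
      ((ε⁻¹ : ℂ) • (BDot.proj s U h).toLinearMap),
      ((BDot.proj s U h).continuous.const_smul (ε⁻¹ : ℂ)).norm, fun φ hφ => H φ ?_⟩
    rw [Seminorm.mem_ball_zero] at hφ
    change ‖(ε⁻¹ : ℂ) • BDot.proj s U h φ‖ < 1 at hφ
    rw [norm_smul, norm_inv, Complex.norm_real, Real.norm_of_nonneg hε.le,
      inv_mul_lt_iff₀ hε, mul_one] at hφ
    exact hφ
  · obtain ⟨h, C, hC, hqC⟩ := exists_le_seminorm hq
    obtain ⟨R, A, N₀, hA, hgrid⟩ := exists_grid_norm_le hs hU h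
    have hh : 0 < h.1 := h.2
    have hA' : (0 : ℝ) < A := by exact_mod_cast hA
    -- Chosen so that `A^d · h / h₁ = 1/2`: the decay of the samples beats the growth of the grids.
    let h₁ : Set.Ioi (0 : ℝ) := ⟨h.1 * (2 * (A : ℝ) ^ d), by
      rw [Set.mem_Ioi]; positivity⟩
    have hρ : (A : ℝ) ^ d * (h.1 / h₁.1) < 1 := by
      change (A : ℝ) ^ d * (h.1 / (h.1 * (2 * (A : ℝ) ^ d))) < 1
      have : (A : ℝ) ^ d * (h.1 / (h.1 * (2 * (A : ℝ) ^ d))) = 1 / 2 := by field_simp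
      rw [this]; norm_num
    have hρ0 : 0 ≤ h.1 / h₁.1 := div_nonneg h.2.le h₁.2.le
    refine isNuclearMap_toLocalBanach (BDot.continuous_seminorm h₁)
      (fun i : (Σ α : Fin d → ℕ, (Fin d → Fin (N₀ * A ^ ∑ j, α j))) =>
        (sampleClosure hU i.1 (gridPt R i.2)).comp (BDot.proj s U h).toLinearMap)
      (fun i => pow_nonneg hρ0 _) (summable_grid hρ0 hρ) (fun i φ => ?_)
      (C := C * 2) (fun φ D hD H => ?_)
    · exact norm_sampleClosure_le_of_fn_eq hU i.1 _
        ((BDot.proj_fn h φ).trans (BDot.proj_fn h₁ φ).symm)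
    · have h1 := hgrid (BDot.proj s U h φ) D hD fun α k => H ⟨α, k⟩
      calc q φ ≤ C * ‖BDot.proj s U h φ‖ := hqC φ
        _ ≤ C * (2 * D) := by gcongr
        _ = C * 2 * D := by ring

theorem isFSSpace_BDot (hs : 0 ≤ s) (hU : Bornology.IsBounded (U : Set (Eu d))) :
    IsFSSpace (BDot s U) := by
  let H : ℕ → Set.Ioi (0 : ℝ) := fun n => ⟨(n : ℝ) + 1, Set.mem_Ioi.2 n.cast_add_one_pos⟩
  have hH : StrictMono H := fun m n hmn => by
    change (m : ℝ) + 1 < n + 1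
    exact_mod_cast Nat.succ_lt_succ hmn
  refine ⟨fun n => LpClosure s ⊤ (H n) U, fun n => inferInstance, fun n => inferInstance,
    fun m n hmn => linkClosure s U (hH.monotone hmn), fun n => BDot.proj s U (H n),
    fun n => completeSpace_lpClosure hU, isTVSProjectiveLimit_BDot hH.monotone fun h => ?_,
    fun m n hmn => isCompactOperator_linkClosure hs hU (hH hmn)⟩
  obtain ⟨n, hn⟩ := exists_nat_ge h.1
  exact ⟨n, show h.1 ≤ (n : ℝ) + 1 by linarith⟩

end Gevrey

end

open Gevrey in
theorem proposition60 {d : ℕ} {s : ℝ} (hs : 1 < s) (U : Opens (Eu d))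
    (hU : Bornology.IsBounded (U : Set (Eu d))) :
    -- i), first part: smooth extension with support in the closure of `U`
    (∀ (p : ENNReal) [Fact (1 ≤ p)] (h : Set.Ioi (0 : ℝ)) (φ : LpClosure s p h U),
      ∃ ψ : Eu d → ℂ, ContDiff ℝ ∞ ψ ∧ tsupport ψ ⊆ closure (U : Set (Eu d)) ∧
        ∀ x : U, ψ x = φ.1.fn x) ∧
    -- i), second part: extension by zero is an isometry onto a closed subspace
    (∀ h : Set.Ioi (0 : ℝ),
      ∃ ι : LpClosure s ⊤ h U →ₗᵢ[ℂ] Comp s h (closure (U : Set (Eu d))),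
        (∀ φ, (ι φ).fn = zeroExt U φ.1.fn) ∧ IsClosed (Set.range ι)) ∧
    -- ii): extension by zero identifies `Ḃ^{(s)}(U)` with a closed subspace
    (∃ ι : BDot s U →L[ℂ] BeurlingComp s (closure (U : Set (Eu d))),
      (∀ φ, (ι φ).fn = zeroExt U φ.1.fn) ∧ IsClosedEmbedding ι) ∧
    -- iii): nuclear (FS)-space, with compact linking inclusions in the projective limit
    IsNuclearSpace (BDot s U) ∧ IsFSSpace (BDot s U) ∧
    (∃ (u : ∀ h h₁ : Set.Ioi (0 : ℝ), h ≤ h₁ → (LpClosure s ⊤ h₁ U →L[ℂ] LpClosure s ⊤ h U))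
      (π : ∀ h : Set.Ioi (0 : ℝ), BDot s U →L[ℂ] LpClosure s ⊤ h U),
      (∀ h h₁ hle φ, (u h h₁ hle φ).1.fn = φ.1.fn) ∧
      (∀ h φ, (π h φ).1.fn = φ.1.fn) ∧
      IsTVSProjectiveLimit u π ∧
      ∀ h h₁ (hlt : h < h₁), IsCompactOperator (u h h₁ hlt.le)) := by
  refine ⟨fun p _ h φ => ⟨zeroExt U φ.1.fn, contDiff_zeroExt hU φ.2, tsupport_zeroExt_subset _,
      fun x => zeroExt_apply _ x⟩,
    fun h => ⟨extComp s h hU, fun φ => extComp_fn hU φ, isClosed_range_extComp hU⟩,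
    ⟨⟨BDot.extₗ s hU, (isClosedEmbedding_extₗ hU).continuous⟩, fun φ => rfl,
      isClosedEmbedding_extₗ hU⟩,
    isNuclearSpace_BDot (by linarith) hU, isFSSpace_BDot (by linarith) hU,
    fun h h₁ hle => linkClosure s U hle, fun h => BDot.proj s U h,
    fun h h₁ hle φ => linkClosure_fn hle φ, fun h φ => BDot.proj_fn h φ,
    isTVSProjectiveLimit_BDot monotone_id fun h => ⟨h, le_rfl⟩,
    fun h h₁ hlt => isCompactOperator_linkClosure (by linarith) hU hlt⟩
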